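/- Let $\Omega\subset\mathbb R^d$ ($d\ge1$) be open and bounded, $T>0$, $\alpha\in(0,1)$, and for $t\in(0,T]$ let $$L v=L(t)v=-\sum_{i,j}\partial_{x_i}\bigl(a_{ij}(x,t)\,\partial_{x_j}v\bigr)+\sum_i b_i(x,t)\,\partial_{x_i}v+c(x,t)\,v .$$ For each $t\in(0,T]$ the matrix $\{a_{ij}(\cdot,t)\}$ is symmetric and uniformly positive definite in $\Omega$, $a_{ij}(\cdot,t)\in C^1(\Omega)$, and $a_{ij}(\cdot,t)$, $b_i(\cdot,t)$, $c(\cdot,t)$ are bounded and measurable in $\Omega$. Assume that for some $\mu\in\mathbb R$ one has $\langle L(t)v,v\rangle\ge\mu\|v\|^2_{L_2(\Omega)}$ for all $v\in H^1_0(\Omega)$ and $t\in(0,T]$, where $\langle L(t)v,v\rangle$ is the bilinear form of $L(t)$ on $H_0^1(\Omega)$ (the closure of $C_c^\infty(\Omega)$ in $H^1(\Omega)$). Let $D_t^\alpha v(t)=\frac1{\Gamma(1-\alpha)}\int_0^t(t-s)^{-\alpha}\,\partial_s v(s)\,ds$ be the Caputo derivative (the integral being improper at $s=0$). Let $f(\cdot,t)$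 be locally integrable in $\Omega$ for each $t\in(0,T]$ and $u_0\in L_2(\Omega)$. Let $u$ and $u_h$ be in $C([0,T];L_2(\Omega))\cap W^1_\infty(\epsilon,t;L_2(\Omega))$ for all $0<\epsilon<t\le T$, with $u(\cdot,t),u_h(\cdot,t)\in H^1_0(\Omega)$ for $t\in(0,T]$ and $u(\cdot,0)=u_h(\cdot,0)=u_0$. Suppose that $D_t^\alpha u+Lu=f$ in the sense of distributions in $\Omega$ for each $t\in(0,T]$, and that the residual $R_h(\cdot,t)=(D_t^\alpha+L)u_h(\cdot,t)-f(\cdot,t)$, understood in the same sense, is a locally integrable function for each $t\in(0,T]$. Let $\lambda,\omega\in\mathbb R$ with $\omega\ge0$, and suppose that there is $g\in C^2(\Omega)$ such that $L(t)g\ge\lambda$ in $\Omega$ for all $t\in(0,T]$ and $1\le g\le1+\omega$ in $\Omega$. For $\tau>0$ set $$\mathcal R_0(t)=\frac{t^{-\alpha}}{\Gamma(1-\alpha)}+\lambda,\qquad \mathcal R_1(t)=\frac{t^{-1}\rho(\tau/t)}{\Gamma(1-\alpha)}+\lambda\max\{\tau,t\}^{\alpha-1},\qquad \rho(s)=s^{-(1-\alpha)}\bigl[1-(\max\{0,1-s\})^{1-\alpha}\bigr].$$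 Then for any $TOL>0$ and $\tau>0$ the error $e=u_h-u$ satisfies: 1. if $\|R_h(\cdot,t)\|_{L_\infty(\Omega)}\le \dfrac{TOL\cdot\mathcal R_0(t)}{1+\omega}$ for all $t\in(0,T]$, then $\|e(\cdot,t)\|_{L_\infty(\Omega)}\le TOL$ for all $t\in[0,T]$; 2. if $\|R_h(\cdot,t)\|_{L_\infty(\Omega)}\le \dfrac{TOL\cdot\mathcal R_1(t)}{1+\omega}$ for all $t\in(0,T]$, then $\|e(\cdot,t)\|_{L_\infty(\Omega)}\le TOL\cdot t^{\alpha-1}$ for all $t\in(0,T]$. -/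

import Mathlib

open Set Filter Topology MeasureTheory
open scoped ENNReal

noncomputable section

namespace Subdiffusion

/-- The space `ℝ^d` with its Euclidean norm. -/
abbrev Space (d : ℕ) := EuclideanSpace ℝ (Fin d)

/-- Lebesgue measure on `Ω`. -/
abbrev vol {d : ℕ} (Ω : Set (Space d)) : Measure (Space d) := volume.restrict Ω

/-- The space `L_2(Ω)`. -/
abbrev L2 {d : ℕ} (Ω : Set (Space d)) := Lp ℝ 2 (vol Ω)

/-- The classical partial derivative `∂_{x_i} h`. -/
def pderiv {d : ℕ} (i : Fin d) (h : Space d → ℝ) (x : Space d) : ℝ :=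
  fderiv ℝ h x (EuclideanSpace.single i 1)

/-- The classical gradient. -/
def grad {d : ℕ} (h : Space d → ℝ) (x : Space d) : Space d :=
  WithLp.toLp 2 (fun i => pderiv i h x)

/-- Test functions, that is, elements of `C_c^∞(Ω)`. -/
structure IsTestFun {d : ℕ} (Ω : Set (Space d)) (φ : Space d → ℝ) : Prop where
  smooth : ContDiff ℝ (⊤ : ℕ∞) φ
  compact : HasCompactSupport φ
  support : tsupport φ ⊆ Ω

/-- `v ∈ H^1_0(Ω)` with (weak) gradient `G`, where `H^1_0(Ω)` is the closure of `C_c^∞(Ω)` in the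
norm of `H^1(Ω)`: there are test functions `φ n` with `φ n → v` and `∇ φ n → G` in `L_2(Ω)`.
Such a `G` is determined by `v` almost everywhere in an open set `Ω`. -/
structure HasH10Grad {d : ℕ} (Ω : Set (Space d)) (v : Space d → ℝ) (G : Space d → Space d) :
    Prop where
  memLp : MemLp v 2 (vol Ω)
  memLp_grad : MemLp G 2 (vol Ω)
  approx : ∃ φ : ℕ → Space d → ℝ, (∀ n, IsTestFun Ω (φ n)) ∧
    Tendsto (fun n => eLpNorm (fun x => φ n x - v x) 2 (vol Ω)) atTop (𝓝 0) ∧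
    Tendsto (fun n => eLpNorm (fun x => grad (φ n) x - G x) 2 (vol Ω)) atTop (𝓝 0)

/-- Membership in `H^1_0(Ω)`. -/
def MemH10 {d : ℕ} (Ω : Set (Space d)) (v : Space d → ℝ) : Prop :=
  ∃ G : Space d → Space d, HasH10Grad Ω v G

/-- `r ∈ L_∞(Ω)` and `‖r‖_{L_∞(Ω)} ≤ K` (in particular, `K` cannot be negative). -/
def LinftyLE {d : ℕ} (Ω : Set (Space d)) (r : Space d → ℝ) (K : ℝ) : Prop :=
  MemLp r ∞ (vol Ω) ∧ (eLpNorm r ∞ (vol Ω)).toReal ≤ K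

/-! ### The spatial operator -/

/-- The coefficients `a_{ij}(x,t)`, `b_i(x,t)`, `c(x,t)` of the second-order operator
`L(t) v = - ∑ ∂_i (a_{ij} ∂_j v) + ∑ b_i ∂_i v + c v`; the first argument is the time. -/
structure SpatialOperator (d : ℕ) where
  a : ℝ → Space d → Matrix (Fin d) (Fin d) ℝ
  b : ℝ → Space d → Fin d → ℝ
  c : ℝ → Space d → ℝ

namespace SpatialOperator

/-- At each time in `(0,T]` the matrix `a` is symmetric and uniformly positive definite in `Ω`, its
entries are in `C^1(Ω)`, and all coefficients are measurable and bounded in `Ω`.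
(No uniformity or regularity in time is asked for.) -/
structure IsElliptic {d : ℕ} (L : SpatialOperator d) (Ω : Set (Space d)) (T : ℝ) : Prop where
  symm : ∀ t ∈ Ioc 0 T, ∀ x ∈ Ω, (L.a t x).IsSymm
  posDef : ∀ t ∈ Ioc 0 T, ∃ θ : ℝ, 0 < θ ∧ ∀ x ∈ Ω, ∀ ξ : Fin d → ℝ,
    θ * ∑ i, ξ i ^ 2 ≤ ∑ i, ∑ j, L.a t x i j * ξ j * ξ i
  contDiffOn_a : ∀ t ∈ Ioc 0 T, ∀ i j, ContDiffOn ℝ 1 (fun x => L.a t x i j) Ω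
  measurable_b : ∀ t ∈ Ioc 0 T, ∀ i, AEStronglyMeasurable (fun x => L.b t x i) (vol Ω)
  measurable_c : ∀ t ∈ Ioc 0 T, AEStronglyMeasurable (L.c t) (vol Ω)
  bounded : ∀ t ∈ Ioc 0 T, ∃ M : ℝ, ∀ x ∈ Ω,
    (∀ i j, |L.a t x i j| ≤ M) ∧ (∀ i, |L.b t x i| ≤ M) ∧ |L.c t x| ≤ M

/-- The pointwise value `(L(t) g)(x)` for a twice differentiable `g`. -/
def apply {d : ℕ} (L : SpatialOperator d) (t : ℝ) (g : Space d → ℝ) (x : Space d) : ℝ :=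
  -(∑ i, ∑ j, pderiv i (fun y => L.a t y i j * pderiv j g y) x)
    + ∑ i, L.b t x i * pderiv i g x + L.c t x * g x

/-- The weak form `⟨L(t) v, φ⟩`, where `G` is the gradient of `v` and `Φ` the gradient of `φ`. -/
def form {d : ℕ} (L : SpatialOperator d) (Ω : Set (Space d)) (t : ℝ)
    (v : Space d → ℝ) (G : Space d → Space d) (φ : Space d → ℝ) (Φ : Space d → Space d) : ℝ :=
  ∫ x in Ω, ((∑ i, ∑ j, L.a t x i j * G x j * Φ x i)
    + (∑ i, L.b t x i * G x i) * φ x + L.c t x * v x * φ x)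

/-- `⟨L(t) v, v⟩ ≥ μ ‖v‖²` for all `v ∈ H^1_0(Ω)` and `t ∈ (0,T]`. -/
def LowerBound {d : ℕ} (L : SpatialOperator d) (Ω : Set (Space d)) (T μ : ℝ) : Prop :=
  ∀ t ∈ Ioc 0 T, ∀ (v : Space d → ℝ) (G : Space d → Space d), HasH10Grad Ω v G →
    μ * ∫ x in Ω, v x ^ 2 ≤ L.form Ω t v G v G

end SpatialOperator

/-! ### Functions of time with values in a Banach space -/

section Time

variable {X : Type*} [NormedAddCommGroup X] [NormedSpace ℝ X]

/-- `v'` is the time derivative of the absolutely continuous function `v` on `[p,q]`. -/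
def IsTimeDeriv (v v' : ℝ → X) (p q : ℝ) : Prop :=
  IntegrableOn v' (Ioo p q) ∧ ∀ x ∈ Icc p q, ∀ y ∈ Icc p q, v y - v x = ∫ s in x..y, v' s

/-- `v ∈ W^1_∞(p,q; X)`. -/
def MemW1Inf (v : ℝ → X) (p q : ℝ) : Prop :=
  ∃ v' : ℝ → X, IsTimeDeriv v v' p q ∧ MemLp v' ∞ (volume.restrict (Ioo p q))

/-- `D = D_t^α v(t)`, the Caputo derivative `Γ(1-α)⁻¹ ∫_0^t (t-s)^{-α} ∂_s v(s) ds`; the integral is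
understood as improper at `s = 0`, where `∂_s v` may be unbounded. -/
def HasCaputoDeriv (α : ℝ) (v : ℝ → X) (t : ℝ) (D : X) : Prop :=
  ∃ v' : ℝ → X,
    (∀ ε ∈ Ioo 0 t, IsTimeDeriv v v' ε t ∧
      IntegrableOn (fun s => (t - s) ^ (-α) • v' s) (Ioo ε t)) ∧
    Tendsto (fun ε => (Real.Gamma (1 - α))⁻¹ • ∫ s in ε..t, (t - s) ^ (-α) • v' s) (𝓝[>] 0) (𝓝 D)

end Time

/-- The regularity required of the solution and of its approximation:
`v ∈ C([0,T]; L_2(Ω))`, `v ∈ W^1_∞(ε,t; L_2(Ω))` for all `0 < ε < t ≤ T`, and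
`v(·,t) ∈ H^1_0(Ω)` for `t ∈ (0,T]` (which contains the boundary condition `v = 0` on `∂Ω`). -/
structure HasRegularity {d : ℕ} (Ω : Set (Space d)) (T : ℝ) (v : ℝ → L2 Ω) : Prop where
  cont : ContinuousOn v (Icc 0 T)
  memW1Inf : ∀ ε t : ℝ, 0 < ε → ε < t → t ≤ T → MemW1Inf v ε t
  memH10 : ∀ t ∈ Ioc 0 T, MemH10 Ω (v t)

/-- `r = (D_t^α + L(t)) v(·,t) - f(·,t)` in the sense of distributions in `Ω`. -/
def IsResidualAt {d : ℕ} (Ω : Set (Space d)) (α : ℝ) (L : SpatialOperator d)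
    (f : ℝ → Space d → ℝ) (v : ℝ → L2 Ω) (t : ℝ) (r : Space d → ℝ) : Prop :=
  LocallyIntegrableOn r Ω ∧
  ∃ (D : L2 Ω) (G : Space d → Space d), HasCaputoDeriv α v t D ∧ HasH10Grad Ω (v t) G ∧
    ∀ φ : Space d → ℝ, IsTestFun Ω φ →
      (∫ x in Ω, D x * φ x) + L.form Ω t (v t) G φ (grad φ) - ∫ x in Ω, f t x * φ x
        = ∫ x in Ω, r x * φ x

/-- `u` solves `D_t^α u + L u = f` in `Ω × (0,T]`, `u(·,0) = u₀`, `u = 0` on `∂Ω`. -/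
structure IsSolution {d : ℕ} (Ω : Set (Space d)) (T α : ℝ) (L : SpatialOperator d)
    (f : ℝ → Space d → ℝ) (u₀ : L2 Ω) (u : ℝ → L2 Ω) : Prop where
  regular : HasRegularity Ω T u
  initial : u 0 = u₀
  equation : ∀ t ∈ Ioc 0 T, IsResidualAt Ω α L f u t 0

/-! ### The residual barriers -/

/-- `R_0(t) = t^{-α} / Γ(1-α) + lam`. -/
def barrier₀ (α lam t : ℝ) : ℝ := (Real.Gamma (1 - α))⁻¹ * t ^ (-α) + lam

/-- `ρ(s) = s^{-β} [1 - ((1-s)^+)^β]` with `β = 1 - α`. -/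
def rho (α s : ℝ) : ℝ := s ^ (-(1 - α)) * (1 - (max 0 (1 - s)) ^ (1 - α))

/-- `R_1(t) = t^{-1} ρ(τ/t) / Γ(1-α) + lam max{τ,t}^{α-1}`. -/
def barrier₁ (α lam τ t : ℝ) : ℝ :=
  (Real.Gamma (1 - α))⁻¹ * t⁻¹ * rho α (τ / t) + lam * (max τ t) ^ (α - 1)

end Subdiffusion

end

open Subdiffusion

/-!
The error `e = u_h - u` satisfies `D_t^α e + L e = R` with `e(0) = 0`, and it is compared with the
barrier `κ E(t) g(x)`, where `κ = TOL / (1 + ω)` and `E` is `1` or `max{τ,t}^{α-1}` for `t > 0` and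
`0` for `t = 0`. The factors `R_0` and `R_1` are exactly `D_t^α E + lam E`; as `D_t^α E ≥ 0`,
`g ≥ 1` and `L g ≥ lam`, the barrier is a supersolution for the right-hand side `R`. As
`g ≤ 1 + ω`, the bound `e ≤ κ E g`, together with the same bound for `-e`, is the claim. It remains
to see that `m(t) = ‖(e(t) - κ E(t) g)^+‖` vanishes (`le_barrier`).

*Space.* For fixed `t` and `ψ = (e(t) - κ E(t) g)^+`, testing the equation with `ψ` gives
`⟨D_t^α e, ψ⟩ + μ ‖ψ‖² + κ E lam ∫ ψ ≤ ∫ R ψ` (`IsElliptic.comparison`). The gradient of `g` need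
not be square-integrable near the boundary, so `ψ` is approximated by `(φ - κ E g)^+` with test
functions `φ → e(t)` in `H^1`. As `g > 0`, these truncations have compact support; they are in
`H^1_0(Ω)` by regularizing the positive part and mollifying, and Green's formula applies to `g` on
their support (`IsElliptic.form_truncation`). Gårding's inequality keeps them bounded in `H^1`,
which is all that the passage to the limit in the bilinear form requires.

*Time.* With `p(s) = ⟨e(s) - κ E(s) g, ψ⟩` one has `p(t) = m(t)²` and `p(s) ≤ m(s) m(t)`.
Integration by parts moves the derivative onto the increasing kernel `(t-s)^{-α}`. If `m` vanishes
up to time `q` and attains its maximum over `[0,t]` at `t`, this gives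
`Γ(1-α) D_t^α p(t) ≥ (t-q)^{-α} p(t)` (`HasCaputoDeriv.lower_bound`). When `t - q ≤ δ` with
`δ^{-α} > Γ(1-α) |μ|`, this contradicts the inequality obtained in space unless `m(t) = 0`. Hence
`m` vanishes on `[0,δ]`, then on `[0,2δ]`, and so on.
-/

namespace Subdiffusion

/-! ### The Caputo derivative -/

section Caputo

variable {X : Type*} [NormedAddCommGroup X] [NormedSpace ℝ X]

lemma IsTimeDeriv.mono {v v' : ℝ → X} {p q p' q' : ℝ} (h : IsTimeDeriv v v' p q) (hp : p ≤ p')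
    (hq : q' ≤ q) : IsTimeDeriv v v' p' q' :=
  ⟨h.1.mono_set (Ioo_subset_Ioo hp hq),
    fun x hx y hy => h.2 x (Icc_subset_Icc hp hq hx) y (Icc_subset_Icc hp hq hy)⟩

lemma IsTimeDeriv.intervalIntegrable {v v' : ℝ → X} {p q : ℝ} (h : IsTimeDeriv v v' p q)
    (hpq : p ≤ q) : IntervalIntegrable v' volume p q :=
  (intervalIntegrable_iff_integrableOn_Ioo_of_le hpq).2 h.1

lemma IsTimeDeriv.sub {v v' w w' : ℝ → X} {p q : ℝ} (hv : IsTimeDeriv v v' p q)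
    (hw : IsTimeDeriv w w' p q) : IsTimeDeriv (fun s => v s - w s) (fun s => v' s - w' s) p q := by
  refine ⟨hv.1.sub hw.1, fun x hx y hy => ?_⟩
  have hpq : p ≤ q := hx.1.trans hx.2
  have hsub : uIcc x y ⊆ uIcc p q := by
    rw [uIcc_of_le hpq]; exact uIcc_subset_Icc hx hy
  rw [intervalIntegral.integral_sub ((hv.intervalIntegrable hpq).mono_set hsub)
    ((hw.intervalIntegrable hpq).mono_set hsub), ← hv.2 x hx y hy, ← hw.2 x hx y hy]
  exact sub_sub_sub_comm _ _ _ _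

lemma IsTimeDeriv.clm [CompleteSpace X] {v v' : ℝ → X} {p q : ℝ} (hv : IsTimeDeriv v v' p q)
    (l : X →L[ℝ] ℝ) : IsTimeDeriv (fun s => l (v s)) (fun s => l (v' s)) p q := by
  refine ⟨l.integrable_comp hv.1, fun x hx y hy => ?_⟩
  have hpq : p ≤ q := hx.1.trans hx.2
  have hsub : uIcc x y ⊆ uIcc p q := by
    rw [uIcc_of_le hpq]; exact uIcc_subset_Icc hx hy
  rw [l.intervalIntegral_comp_comm ((hv.intervalIntegrable hpq).mono_set hsub), ← hv.2 x hx y hy,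
    map_sub]

lemma HasCaputoDeriv.sub {α t : ℝ} (ht : 0 < t) {v w : ℝ → X} {D D' : X}
    (hv : HasCaputoDeriv α v t D)
    (hw : HasCaputoDeriv α w t D') : HasCaputoDeriv α (fun s => v s - w s) t (D - D') := by
  obtain ⟨v', hv1, hv2⟩ := hv
  obtain ⟨w', hw1, hw2⟩ := hw
  refine ⟨fun s => v' s - w' s, fun ε hε => ⟨(hv1 ε hε).1.sub (hw1 ε hε).1, ?_⟩, ?_⟩
  · simpa only [smul_sub] using! (hv1 ε hε).2.sub (hw1 ε hε).2
  · refine (hv2.sub hw2).congr' ?_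
    filter_upwards [Ioo_mem_nhdsGT ht] with ε hε
    rw [← smul_sub, ← intervalIntegral.integral_sub
      ((intervalIntegrable_iff_integrableOn_Ioo_of_le hε.2.le).2 (hv1 ε hε).2)
      ((intervalIntegrable_iff_integrableOn_Ioo_of_le hε.2.le).2 (hw1 ε hε).2)]
    simp only [smul_sub]

lemma HasCaputoDeriv.clm [CompleteSpace X] {α t : ℝ} (ht : 0 < t) {v : ℝ → X} {D : X}
    (hv : HasCaputoDeriv α v t D) (l : X →L[ℝ] ℝ) :
    HasCaputoDeriv α (fun s => l (v s)) t (l D) := by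
  obtain ⟨v', hv1, hv2⟩ := hv
  refine ⟨fun s => l (v' s), fun ε hε => ⟨(hv1 ε hε).1.clm l, ?_⟩, ?_⟩
  · simpa only [map_smul] using! l.integrable_comp (hv1 ε hε).2
  · refine ((l.continuous.tendsto D).comp hv2).congr' ?_
    filter_upwards [Ioo_mem_nhdsGT ht] with ε hε
    have := l.intervalIntegral_comp_comm
      ((intervalIntegrable_iff_integrableOn_Ioo_of_le hε.2.le).2 (hv1 ε hε).2)
    simp only [map_smul] at this
    simp only [Function.comp, map_smul, this]

/-- Integration by parts against a `C^1` weight. -/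
lemma IsTimeDeriv.integral_mul {p p' k : ℝ → ℝ} {a b : ℝ} (hab : a ≤ b)
    (h : IsTimeDeriv p p' a b) (hk : ContDiffOn ℝ 1 k (Icc a b)) :
    ∫ s in a..b, k s * p' s = k b * p b - k a * p a - ∫ s in a..b, deriv k s * p s := by
  have hint := h.intervalIntegrable hab
  have hkac : AbsolutelyContinuousOnInterval k a b :=
    ContDiffOn.absolutelyContinuousOnInterval (by rwa [uIcc_of_le hab])
  have hpac : AbsolutelyContinuousOnInterval (fun s => p a + ∫ r in a..s, p' r) a b := by
    have h1 : AbsolutelyContinuousOnInterval (fun _ : ℝ => p a) a b :=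
      (LipschitzWith.const (p a)).lipschitzOnWith.absolutelyContinuousOnInterval
    exact h1.add (hint.absolutelyContinuousOnInterval_intervalIntegral (c := a) (by simp))
  have heq : ∀ s ∈ Icc a b, p a + ∫ r in a..s, p' r = p s := fun s hs => by
    rw [← h.2 a (left_mem_Icc.2 hab) s hs]; ring
  have := hkac.integral_mul_deriv_eq_deriv_mul hpac
  rw [heq a (left_mem_Icc.2 hab), heq b (right_mem_Icc.2 hab)] at this
  have e1 : ∫ s in a..b, k s * p' s
      = ∫ s in a..b, k s * deriv (fun s => p a + ∫ r in a..s, p' r) s := by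
    refine intervalIntegral.integral_congr_ae ?_
    filter_upwards [hint.ae_hasDerivAt_integral] with s hs hs'
    rw [((hs (uIoc_subset_uIcc hs') a (by simp)).const_add (p a)).deriv]
  rw [e1, this]
  congr 1
  refine intervalIntegral.integral_congr fun s hs => ?_
  rw [uIcc_of_le hab] at hs
  simp only [heq s hs]

lemma IsTimeDeriv.continuousOn {p p' : ℝ → ℝ} {a b : ℝ} (h : IsTimeDeriv p p' a b) :
    ContinuousOn p (Icc a b) := by
  rcases le_or_gt a b with hab | hab
  · have h2 : ContinuousOn (fun s => p a + ∫ r in a..s, p' r) (Icc a b) := by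
      refine continuousOn_const.add ?_
      have := intervalIntegral.continuousOn_primitive_interval (f := p') (a := a) (b := b)
        (μ := volume) ((intervalIntegrable_iff' enorm_ne_top).1 (h.intervalIntegrable hab))
      rwa [uIcc_of_le hab] at this
    refine h2.congr fun s hs => ?_
    simp only
    rw [← h.2 a (left_mem_Icc.2 hab) s hs]; ring
  · simp [Icc_eq_empty (not_le.2 hab)]

lemma hasDerivAt_kernel {α t s : ℝ} (hs : s < t) :
    HasDerivAt (fun s => (t - s) ^ (-α)) (α * (t - s) ^ (-α - 1)) s := by
  have h := ((hasDerivAt_id s).const_sub t).rpow_const (p := -α) (Or.inl (sub_pos.2 hs).ne')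
  refine h.congr_deriv ?_
  simp only [id]; ring

lemma contDiffOn_kernel {α t a b : ℝ} (hb : b < t) :
    ContDiffOn ℝ 1 (fun s => (t - s) ^ (-α)) (Icc a b) :=
  (contDiffOn_const.sub contDiffOn_id).rpow_const_of_ne
    fun _ hs => (sub_pos.2 (hs.2.trans_lt hb)).ne'

/-- If the history of `p` stays below `p t`, and below `η` up to time `q`, then the weighted
integral of `p'` over `(ε,t)` is at least what a step from `η` to `p t` at time `q` would give. -/
lemma kernel_integral_lower {α t ε q η : ℝ} (hα : 0 < α) (hεq : ε ≤ q) (hqt : q < t)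
    {p p' : ℝ → ℝ} (h : IsTimeDeriv p p' ε t)
    (hk : IntegrableOn (fun s => (t - s) ^ (-α) * p' s) (Ioo ε t))
    (hη : ∀ s ∈ Icc ε q, p s ≤ η) (hp : ∀ s ∈ Icc ε t, p s ≤ p t) :
    (t - q) ^ (-α) * (p t - η) + (t - ε) ^ (-α) * η
      ≤ (∫ s in ε..t, (t - s) ^ (-α) * p' s) + (t - ε) ^ (-α) * p ε := by
  have hεt : ε < t := hεq.trans_lt hqt
  set k : ℝ → ℝ := fun s => (t - s) ^ (-α) with hkdef
  have hki : IntervalIntegrable (fun s => k s * p' s) volume ε t :=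
    (intervalIntegrable_iff_integrableOn_Ioo_of_le hεt.le).2 hk
  have hpc := h.continuousOn
  have hderiv : ∀ s < t, deriv k s = α * (t - s) ^ (-α - 1) := fun s hs =>
    (hasDerivAt_kernel hs).deriv
  have hkc : ∀ a b, b < t → ContinuousOn (deriv k) (Icc a b) := fun a b hb => by
    refine ContinuousOn.congr (f := fun s => α * (t - s) ^ (-α - 1)) ?_
      fun s hs => hderiv s (hs.2.trans_lt hb)
    refine continuousOn_const.mul (ContinuousOn.rpow_const (by fun_prop) fun _ hs => Or.inl ?_)
    exact (sub_pos.2 (hs.2.trans_lt hb)).ne'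
  have hk' : ∀ s < t, 0 ≤ deriv k s := fun s hs => by
    rw [hderiv s hs]; have := sub_pos.2 hs; positivity
  have hkint : ∀ a b, a ≤ b → b < t → ∫ s in a..b, deriv k s = k b - k a := fun a b hab hb => by
    refine intervalIntegral.integral_deriv_eq_sub (fun s hs => ?_) ?_
    · rw [uIcc_of_le hab] at hs
      exact (hasDerivAt_kernel (hs.2.trans_lt hb)).differentiableAt
    · exact ContinuousOn.intervalIntegrable (by rw [uIcc_of_le hab]; exact hkc a b hb)
  -- integrate by parts on `(ε, r)`, away from the singularity of the kernel
  have key : ∀ r ∈ Ioo q t, k q * (p t - η) + k ε * η - k r * (p t - p r)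
      ≤ (∫ s in ε..r, k s * p' s) + k ε * p ε := by
    intro r hr
    have hεr : ε ≤ r := hεq.trans hr.1.le
    have hibp := (h.mono le_rfl hr.2.le).integral_mul hεr (contDiffOn_kernel (α := α) hr.2)
    have hmul : ∀ a b, ε ≤ a → a ≤ b → b < t →
        IntervalIntegrable (fun s => deriv k s * p s) volume a b := fun a b ha hab hb => by
      refine ContinuousOn.intervalIntegrable ?_
      rw [uIcc_of_le hab]
      exact (hkc a b hb).mul (hpc.mono (Icc_subset_Icc ha hb.le))
    have hmulc : ∀ a b c, a ≤ b → b < t →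
        IntervalIntegrable (fun s => deriv k s * c) volume a b := fun a b c hab hb => by
      refine ContinuousOn.intervalIntegrable ?_
      rw [uIcc_of_le hab]
      exact (hkc a b hb).mul continuousOn_const
    have h1 : ∫ s in ε..q, deriv k s * p s ≤ (k q - k ε) * η := by
      rw [← hkint ε q hεq hqt, ← intervalIntegral.integral_mul_const]
      refine intervalIntegral.integral_mono_on hεq (hmul ε q le_rfl hεq hqt)
        (hmulc _ _ _ hεq hqt) fun s hs => ?_
      exact mul_le_mul_of_nonneg_left (hη s hs) (hk' s (hs.2.trans_lt hqt))
    have h2 : ∫ s in q..r, deriv k s * p s ≤ (k r - k q) * p t := by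
      rw [← hkint q r hr.1.le hr.2, ← intervalIntegral.integral_mul_const]
      refine intervalIntegral.integral_mono_on hr.1.le (hmul q r hεq hr.1.le hr.2)
        (hmulc _ _ _ hr.1.le hr.2) fun s hs => ?_
      exact mul_le_mul_of_nonneg_left (hp s ⟨hεq.trans hs.1, hs.2.trans hr.2.le⟩)
        (hk' s (hs.2.trans_lt hr.2))
    have h3 := intervalIntegral.integral_add_adjacent_intervals (hmul ε q le_rfl hεq hqt)
      (hmul q r hεq hr.1.le hr.2)
    simp only [hkdef] at *
    rw [hibp]
    linarith
  have hlim : Tendsto (fun r => ∫ s in ε..r, k s * p' s) (𝓝[<] t)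
      (𝓝 (∫ s in ε..t, k s * p' s)) := by
    have := intervalIntegral.continuousOn_primitive_interval (f := fun s => k s * p' s) (a := ε)
      (b := t) (μ := volume) ((intervalIntegrable_iff' enorm_ne_top).1 hki)
    rw [uIcc_of_le hεt.le] at this
    exact (this t (right_mem_Icc.2 hεt.le)).mono_left
      (nhdsWithin_le_of_mem (mem_of_superset (Ioo_mem_nhdsLT hεt) Ioo_subset_Icc_self))
  -- the boundary term vanishes as `r → t`, since `k r * |p t - p r|` is at most the integral of
  -- `k * |p'|` over `(r, t)`
  have hlim2 : Tendsto (fun r => k r * (p t - p r)) (𝓝[<] t) (𝓝 0) := by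
    have hn : IntervalIntegrable (fun s => ‖k s * p' s‖) volume ε t := hki.norm
    have h0 : Tendsto (fun r => (∫ s in ε..t, ‖k s * p' s‖) - ∫ s in ε..r, ‖k s * p' s‖) (𝓝[<] t)
        (𝓝 0) := by
      have := intervalIntegral.continuousOn_primitive_interval (f := fun s => ‖k s * p' s‖)
        (a := ε) (b := t) (μ := volume) ((intervalIntegrable_iff' enorm_ne_top).1 hn)
      rw [uIcc_of_le hεt.le] at this
      have h4 := (this t (right_mem_Icc.2 hεt.le)).mono_left
        (nhdsWithin_le_of_mem (mem_of_superset (Ioo_mem_nhdsLT hεt) Ioo_subset_Icc_self))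
      simpa using h4.const_sub (∫ s in ε..t, ‖k s * p' s‖)
    refine squeeze_zero_norm' ?_ h0
    filter_upwards [Ioo_mem_nhdsLT hεt] with r hr
    have hsub1 : uIcc ε r ⊆ uIcc ε t := by
      rw [uIcc_of_le hεt.le, uIcc_of_le hr.1.le]; exact Icc_subset_Icc le_rfl hr.2.le
    have hsub2 : uIcc r t ⊆ uIcc ε t := by
      rw [uIcc_of_le hεt.le, uIcc_of_le hr.2.le]; exact Icc_subset_Icc hr.1.le le_rfl
    rw [← intervalIntegral.integral_add_adjacent_intervals (hn.mono_set hsub1)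
      (hn.mono_set hsub2), add_sub_cancel_left,
      h.2 r ⟨hr.1.le, hr.2.le⟩ t ⟨hεt.le, le_rfl⟩, ← intervalIntegral.integral_const_mul]
    refine (intervalIntegral.norm_integral_le_integral_norm hr.2.le).trans ?_
    refine intervalIntegral.integral_mono_on_of_le_Ioo hr.2.le ?_ (hn.mono_set hsub2)
      fun s hs => ?_
    · exact (((h.intervalIntegrable hεt.le).mono_set hsub2).const_mul _).norm
    · rw [norm_mul, norm_mul]
      refine mul_le_mul_of_nonneg_right ?_ (norm_nonneg _)
      have hrt : 0 < t - r := sub_pos.2 hr.2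
      have hst : 0 < t - s := sub_pos.2 hs.2
      rw [Real.norm_of_nonneg (by positivity), Real.norm_of_nonneg (by positivity)]
      exact Real.rpow_le_rpow_of_nonpos hst (by linarith [hs.1]) (by linarith)
  have := le_of_tendsto_of_tendsto (tendsto_const_nhds.sub hlim2) (hlim.add_const (k ε * p ε))
    (by filter_upwards [Ioo_mem_nhdsLT hqt] with r hr using key r hr)
  simpa only [sub_zero] using! this

/-- The maximum principle for the Caputo derivative, in a quantitative form: `p` attains its maximum
over `(0,t]` at `t`, is nonpositive up to time `q`, and may jump at time `0`, where its right limit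
is `p₀`; the jump accounts for the last term. -/
lemma HasCaputoDeriv.lower_bound {α t q p₀ D : ℝ} (hα : α ∈ Ioo (0 : ℝ) 1) (hq : 0 ≤ q)
    (hqt : q < t) {p : ℝ → ℝ} (h : HasCaputoDeriv α p t D) (hp₀ : Tendsto p (𝓝[>] 0) (𝓝 p₀))
    (hneg : ∀ s ∈ Ioc 0 q, p s ≤ 0) (hp : ∀ s ∈ Ioc 0 t, p s ≤ p t) :
    (t - q) ^ (-α) * p t ≤ Real.Gamma (1 - α) * D + t ^ (-α) * p₀ := by
  have ht : 0 < t := hq.trans_lt hqt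
  have hΓ : 0 < Real.Gamma (1 - α) := Real.Gamma_pos_of_pos (by linarith [hα.2])
  obtain ⟨p', h1, h2⟩ := h
  have hI : Tendsto (fun ε => ∫ s in ε..t, (t - s) ^ (-α) * p' s) (𝓝[>] 0)
      (𝓝 (Real.Gamma (1 - α) * D)) := by
    refine (h2.const_mul (Real.Gamma (1 - α))).congr fun ε => ?_
    simp only [smul_eq_mul]
    rw [← mul_assoc, mul_inv_cancel₀ hΓ.ne', one_mul]
  have hk : ContinuousAt (fun ε => (t - ε) ^ (-α)) 0 :=
    (hasDerivAt_kernel (by simpa using ht)).continuousAt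
  have hk0 : Tendsto (fun ε => (t - ε) ^ (-α)) (𝓝[>] 0) (𝓝 (t ^ (-α))) := by
    simpa using hk.tendsto.mono_left nhdsWithin_le_nhds
  have hup := hI.add (hk0.mul hp₀)
  have hsm : ∀ ε ∈ Ioo 0 t, IntegrableOn (fun s => (t - s) ^ (-α) * p' s) (Ioo ε t) :=
    fun ε hε => by simpa only [smul_eq_mul] using (h1 ε hε).2
  rcases hq.eq_or_lt with rfl | hq
  · rw [sub_zero]
    refine le_of_tendsto_of_tendsto (hk0.mul_const (p t)) hup ?_
    filter_upwards [Ioo_mem_nhdsGT ht] with ε hε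
    have := kernel_integral_lower hα.1 le_rfl hε.2 (h1 ε hε).1 (hsm ε hε) (η := p ε)
      (fun s hs => by rw [le_antisymm hs.2 hs.1]) (fun s hs => hp s ⟨hε.1.trans_le hs.1, hs.2⟩)
    linarith
  · refine ge_of_tendsto hup ?_
    filter_upwards [Ioo_mem_nhdsGT hq] with ε hε
    have hε' : ε ∈ Ioo 0 t := ⟨hε.1, hε.2.trans hqt⟩
    have := kernel_integral_lower hα.1 hε.2.le hqt (h1 ε hε').1 (hsm ε hε') (η := 0)
      (fun s hs => hneg s ⟨hε.1.trans_le hs.1, hs.2⟩)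
      (fun s hs => hp s ⟨hε.1.trans_le hs.1, hs.2⟩)
    linarith

lemma hasCaputoDeriv_const {α t c : ℝ} : HasCaputoDeriv α (fun _ => c) t 0 := by
  refine ⟨fun _ => 0, fun ε _ => ⟨⟨integrableOn_zero, fun x _ y _ => by simp⟩, ?_⟩, by simp⟩
  simp

lemma rho_nonneg {α s : ℝ} (hα : α < 1) (hs : 0 < s) : 0 ≤ rho α s := by
  unfold rho
  have h1 : (max 0 (1 - s)) ^ (1 - α) ≤ 1 :=
    Real.rpow_le_one (le_max_left _ _) (max_le zero_le_one (by linarith)) (by linarith)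
  exact mul_nonneg (Real.rpow_nonneg hs.le _) (by linarith)

lemma intervalIntegrable_kernel {α ε t : ℝ} (hα : α < 1) :
    IntervalIntegrable (fun s => (t - s) ^ (-α)) volume ε t := by
  have := (intervalIntegral.intervalIntegrable_rpow' (a := 0) (b := t - ε) (r := -α)
    (by linarith)).comp_sub_left t
  simpa using this.symm

/-- The Caputo derivative of `max{τ,s}^{α-1}`. The constant value near `0` enters only through the
subtracted term: the barrier jumps from `0` to this value at time `0`. -/
lemma hasCaputoDeriv_max_rpow {α τ t : ℝ} (hα : α ∈ Ioo (0 : ℝ) 1) (hτ : 0 < τ) (ht : 0 < t) :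
    HasCaputoDeriv α (fun s => (max τ s) ^ (α - 1)) t
      ((Real.Gamma (1 - α))⁻¹ * (t⁻¹ * rho α (τ / t) - t ^ (-α) * τ ^ (α - 1))) := by
  set F' : ℝ → ℝ := (Ioi τ).indicator fun s => (α - 1) * (max τ s) ^ (α - 2) with hF'
  have hpos : ∀ s, 0 < max τ s := fun s => lt_max_of_lt_left hτ
  have hcont : ∀ r : ℝ, Continuous fun s => (max τ s) ^ r := fun r =>
    (continuous_const.max continuous_id).rpow_const fun s => Or.inl (hpos s).ne'
  have hF'i : ∀ a b, IntervalIntegrable F' volume a b := fun a b =>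
    ⟨((continuous_const.mul (hcont _)).intervalIntegrable a b).1.indicator measurableSet_Ioi,
      ((continuous_const.mul (hcont _)).intervalIntegrable a b).2.indicator measurableSet_Ioi⟩
  have hlt : ∀ s, s < τ → (fun s => max τ s) =ᶠ[𝓝 s] fun _ => τ := fun s hs => by
    filter_upwards [Iio_mem_nhds hs] with r hr using max_eq_left hr.le
  have hgt : ∀ s, τ < s → (fun s => max τ s) =ᶠ[𝓝 s] fun s => s := fun s hs => by
    filter_upwards [Ioi_mem_nhds hs] with r hr using max_eq_right (le_of_lt hr)
  have hkF : ∀ ε, ε ≤ t → IntegrableOn (fun s => (t - s) ^ (-α) * F' s) (Ioo ε t) := by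
    intro ε hε
    have h1 := (intervalIntegrable_kernel (ε := ε) (t := t) hα.2).mul_continuousOn
      (continuous_const.mul (hcont (α - 2)) : Continuous fun s => (α - 1) * _).continuousOn
    have h2 := ((intervalIntegrable_iff_integrableOn_Ioo_of_le hε).1 h1).indicator
      (measurableSet_Ioi (a := τ))
    refine h2.congr (ae_of_all _ fun s => ?_)
    by_cases hs : s ∈ Ioi τ <;> simp [hF', hs]
  refine ⟨F', fun ε hε => ⟨⟨?_, fun x _ y _ => ?_⟩, ?_⟩, ?_⟩
  · exact (intervalIntegrable_iff_integrableOn_Ioo_of_le hε.2.le).1 (hF'i _ _)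
  · refine (integral_eq_of_hasDerivAt_off_countable (fun s => (max τ s) ^ (α - 1)) F'
      (countable_singleton τ) (hcont _).continuousOn (fun s hs => ?_) (hF'i _ _)).symm
    rcases lt_or_gt_of_ne (show s ≠ τ from hs.2) with h | h
    · have : F' s = 0 := by simp [hF', h.le]
      rw [this]
      refine (hasDerivAt_const s (τ ^ (α - 1))).congr_of_eventuallyEq ?_
      filter_upwards [hlt s h] with r hr; simp only [hr]
    · have : F' s = (α - 1) * s ^ (α - 2) := by simp [hF', h, max_eq_right h.le]
      rw [this]
      have hd := Real.hasDerivAt_rpow_const (x := s) (p := α - 1) (Or.inl (hτ.trans h).ne')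
      rw [show α - 1 - 1 = α - 2 by ring] at hd
      refine hd.congr_of_eventuallyEq ?_
      filter_upwards [hgt s h] with r hr; simp only [hr]
  · simpa only [smul_eq_mul] using hkF ε hε.2.le
  · -- the integral does not depend on `ε` once `ε < τ`
    refine tendsto_const_nhds.congr' ?_
    filter_upwards [Ioo_mem_nhdsGT (lt_min hτ ht)] with ε hε
    have hετ : ε < τ := hε.2.trans_le (min_le_left _ _)
    have hεt : ε < t := hε.2.trans_le (min_le_right _ _)
    simp only [smul_eq_mul]
    congr 1
    have h1 : t⁻¹ * (τ / t) ^ (-(1 - α)) = t ^ (-α) * τ ^ (α - 1) := by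
      rw [Real.div_rpow hτ.le ht.le, neg_sub, div_eq_mul_inv, ← Real.rpow_neg ht.le, neg_sub,
        show (-α : ℝ) = -1 + (1 - α) by ring, Real.rpow_add ht, Real.rpow_neg_one]
      ring
    rcases le_or_gt t τ with htτ | htτ
    · have : max 0 (1 - τ / t) = 0 := max_eq_left (by
        rw [sub_nonpos, le_div_iff₀ ht]; linarith)
      have h2 : ∫ s in ε..t, (t - s) ^ (-α) * F' s = 0 := by
        refine intervalIntegral.integral_zero_ae (ae_of_all _ fun s hs => ?_)
        rw [uIoc_of_le hεt.le] at hs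
        simp [hF', hs.2.trans htτ]
      rw [h2, rho, this, Real.zero_rpow (by linarith [hα.2]), ← mul_assoc, h1]
      ring
    · -- an explicit antiderivative
      set H : ℝ → ℝ := fun s => t⁻¹ * (t / max τ s - 1) ^ (1 - α) with hH
      have hHc : Continuous H := by
        refine continuous_const.mul (Continuous.rpow_const ?_ fun s => Or.inr (by linarith [hα.2]))
        exact (continuous_const.div (continuous_const.max continuous_id)
          fun s => (hpos s).ne').sub continuous_const
      have h2 : ∫ s in ε..t, (t - s) ^ (-α) * F' s = H t - H ε := by
        refine integral_eq_of_hasDerivAt_off_countable_of_le H _ hεt.le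
          (countable_singleton τ) hHc.continuousOn (fun s hs => ?_)
          ((intervalIntegrable_iff_integrableOn_Ioo_of_le hεt.le).2 (hkF ε hεt.le))
        rcases lt_or_gt_of_ne (show s ≠ τ from hs.2) with h | h
        · have : F' s = 0 := by simp [hF', h.le]
          rw [this, mul_zero]
          refine (hasDerivAt_const s (t⁻¹ * (t / τ - 1) ^ (1 - α))).congr_of_eventuallyEq ?_
          filter_upwards [hlt s h] with r hr; simp only [hH, hr]
        · have : F' s = (α - 1) * s ^ (α - 2) := by simp [hF', h, max_eq_right h.le]
          rw [this]
          have hs0 : 0 < s := hτ.trans h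
          have hst : 0 < t - s := sub_pos.2 hs.1.2
          have hne : t / s - 1 ≠ 0 := by
            have : t / s - 1 = (t - s) / s := by field_simp
            rw [this]; positivity
          have hd : HasDerivAt (fun s => t / s - 1) (-t / s ^ 2) s := by
            refine (((hasDerivAt_inv hs0.ne').const_mul t).sub_const 1).congr_deriv ?_
            ring
          have hd2 := (hd.rpow_const (p := 1 - α) (Or.inl hne)).const_mul t⁻¹
          refine (hd2.congr_of_eventuallyEq ?_).congr_deriv ?_
          · filter_upwards [hgt s h] with r hr; simp only [hH, hr]
          · rw [show t / s - 1 = (t - s) / s by field_simp, show 1 - α - 1 = -α by ring,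
              Real.div_rpow hst.le hs0.le, Real.rpow_neg hs0.le α,
              show α - 2 = α + -2 by ring, Real.rpow_add hs0,
              show (-2 : ℝ) = ((-2 : ℤ) : ℝ) by norm_num, Real.rpow_intCast]
            have := ht.ne'
            have := (Real.rpow_pos_of_pos hs0 α).ne'
            rw [zpow_neg]
            field_simp
            ring
      have h3 : H t = 0 := by
        simp only [hH, max_eq_right htτ.le, div_self ht.ne', sub_self]
        rw [Real.zero_rpow (by linarith [hα.2]), mul_zero]
      have h4 : H ε = t⁻¹ * (t / τ - 1) ^ (1 - α) := by simp only [hH, max_eq_left hετ.le]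
      have h5 : 0 ≤ 1 - τ / t := by rw [sub_nonneg, div_le_one ht]; exact htτ.le
      have h6 : (t / τ - 1) ^ (1 - α) = (τ / t) ^ (-(1 - α)) * (1 - τ / t) ^ (1 - α) := by
        rw [Real.rpow_neg (by positivity), ← Real.inv_rpow (by positivity),
          ← Real.mul_rpow (by positivity) h5]
        congr 1
        field_simp
      rw [h2, h3, h4, h6, rho, max_eq_right h5, ← h1]
      ring

end Caputo

/-! ### Test functions and `H^1_0(Ω)` -/

section Space

variable {d : ℕ} {Ω : Set (Space d)}

lemma isFiniteMeasure_vol (hΩb : Bornology.IsBounded Ω) : IsFiniteMeasure (vol Ω) :=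
  ⟨by rw [Measure.restrict_apply_univ]; exact hΩb.measure_lt_top⟩

lemma grad_apply (h : Space d → ℝ) (x : Space d) (i : Fin d) : grad h x i = pderiv i h x := rfl

lemma continuous_toLp_apply : Continuous fun A : Space d →L[ℝ] ℝ =>
    (WithLp.toLp 2 (fun i => A (EuclideanSpace.single i 1)) : Space d) := by
  refine (PiLp.continuous_toLp 2 _).comp (continuous_pi fun i => ?_)
  exact (ContinuousLinearMap.apply ℝ ℝ (EuclideanSpace.single i (1 : ℝ) : Space d)).continuous

lemma continuous_grad {h : Space d → ℝ} (hh : ContDiff ℝ 1 h) : Continuous (grad h) :=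
  continuous_toLp_apply.comp (hh.continuous_fderiv one_ne_zero)

lemma continuousOn_grad {h : Space d → ℝ} (hΩ : IsOpen Ω) (hh : ContDiffOn ℝ 1 h Ω) :
    ContinuousOn (grad h) Ω :=
  continuous_toLp_apply.comp_continuousOn (hh.continuousOn_fderiv_of_isOpen hΩ le_rfl)

lemma grad_eq_zero_of_notMem_tsupport {h : Space d → ℝ} {x : Space d} (hx : x ∉ tsupport h) :
    grad h x = 0 := by
  ext i
  rw [grad_apply, pderiv, fderiv_of_notMem_tsupport ℝ hx]
  simp

lemma norm_le_of_abs_apply_le {v : Space d} {C : ℝ} (hC : 0 ≤ C) (h : ∀ i, |v i| ≤ C) :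
    ‖v‖ ≤ (d + 1) * C := by
  refine le_of_sq_le_sq ?_ (by positivity)
  rw [EuclideanSpace.norm_sq_eq]
  calc ∑ i, ‖v i‖ ^ 2 ≤ ∑ _i : Fin d, C ^ 2 := Finset.sum_le_sum fun i _ => by
        rw [Real.norm_eq_abs]; exact pow_le_pow_left₀ (abs_nonneg _) (h i) 2
    _ = d * C ^ 2 := by simp
    _ ≤ ((d + 1) * C) ^ 2 := by
        have : (0 : ℝ) ≤ d := Nat.cast_nonneg d
        nlinarith [sq_nonneg C, mul_nonneg this (sq_nonneg C),
          mul_nonneg (mul_nonneg this this) (sq_nonneg C)]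

/-- Mollification: compactly supported `C^1` functions are limits of test functions in `C^1`. -/
lemma exists_isTestFun_near (hΩ : IsOpen Ω) {ψ : Space d → ℝ} (hψ : ContDiff ℝ 1 ψ)
    (hc : HasCompactSupport ψ) (hs : tsupport ψ ⊆ Ω) {ε : ℝ} (hε : 0 < ε) :
    ∃ φ, IsTestFun Ω φ ∧ ∀ x, ‖φ x - ψ x‖ ≤ ε ∧ ‖grad φ x - grad ψ x‖ ≤ ε := by
  obtain ⟨δ₀, hδ₀, hδ₀'⟩ := hc.isCompact.exists_cthickening_subset_open hΩ hs
  set η : ℝ := ε / (d + 1) with hη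
  have hη0 : 0 < η := by positivity
  have hηε : η ≤ ε := div_le_self hε.le (by linarith [(Nat.cast_nonneg d : (0 : ℝ) ≤ d)])
  obtain ⟨δ₁, hδ₁, h₁⟩ := Metric.uniformContinuous_iff.1
    (hc.uniformContinuous_of_continuous hψ.continuous) η hη0
  have hgc : HasCompactSupport (grad ψ) := HasCompactSupport.intro hc.isCompact
    fun x hx => grad_eq_zero_of_notMem_tsupport hx
  obtain ⟨δ₂, hδ₂, h₂⟩ := Metric.uniformContinuous_iff.1
    (hgc.uniformContinuous_of_continuous (continuous_grad hψ)) η hη0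
  set δ := min δ₀ (min δ₁ δ₂) with hδ
  have hδpos : 0 < δ := lt_min hδ₀ (lt_min hδ₁ hδ₂)
  let b : ContDiffBump (0 : Space d) := ⟨δ / 2, δ, by positivity, by linarith⟩
  set φ : Space d → ℝ :=
    convolution (b.normed volume) ψ (ContinuousLinearMap.lsmul ℝ ℝ) volume with hφ
  have hsupp : Function.support φ ⊆ Metric.cthickening δ₀ (tsupport ψ) := by
    refine (support_convolution_subset _).trans ?_
    rintro _ ⟨y, hy, z, hz, rfl⟩
    rw [b.support_normed_eq] at hy
    refine Metric.mem_cthickening_of_dist_le _ z _ _ (subset_tsupport _ hz) ?_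
    have : dist y 0 < δ := hy
    rw [dist_zero_right] at this
    simpa [dist_eq_norm] using this.le.trans (min_le_left _ _)
  have hts : tsupport φ ⊆ Metric.cthickening δ₀ (tsupport ψ) :=
    closure_minimal hsupp Metric.isClosed_cthickening
  refine ⟨φ, ⟨?_, ?_, hts.trans hδ₀'⟩, fun x => ⟨?_, ?_⟩⟩
  · exact b.hasCompactSupport_normed.contDiff_convolution_left _ b.contDiff_normed
      hψ.continuous.locallyIntegrable
  · exact hc.isCompact.cthickening.of_isClosed_subset (isClosed_tsupport _) hts
  · rw [← dist_eq_norm]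
    refine (b.dist_normed_convolution_le hψ.continuous.aestronglyMeasurable
      fun y hy => (h₁ ?_).le).trans hηε
    exact (Metric.mem_ball.1 hy).trans_le ((min_le_right _ _).trans (min_le_left _ _))
  · have hd : ∀ i, |(grad φ x - grad ψ x) i| ≤ η := fun i => by
      have h3 : grad φ x i = convolution (b.normed volume) (fun y => pderiv i ψ y)
          (ContinuousLinearMap.lsmul ℝ ℝ) volume x := by
        rw [grad_apply, pderiv, (hc.hasFDerivAt_convolution_right _
          b.continuous_normed.locallyIntegrable hψ x).fderiv]
        exact convolution_precompR_apply _ b.continuous_normed.locallyIntegrable (hc.fderiv ℝ)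
          (hψ.continuous_fderiv one_ne_zero) x _
      rw [PiLp.sub_apply, h3, grad_apply, ← Real.norm_eq_abs, ← dist_eq_norm]
      refine b.dist_normed_convolution_le (g := fun y => pderiv i ψ y) ?_ fun y hy => ?_
      · exact ((hψ.continuous_fderiv one_ne_zero).clm_apply continuous_const).aestronglyMeasurable
      · have h4 := h₂ ((Metric.mem_ball.1 hy).trans_le
          ((min_le_right _ _).trans (min_le_right _ _)))
        refine le_trans ?_ h4.le
        rw [dist_eq_norm, dist_eq_norm]
        exact PiLp.norm_apply_le (grad ψ y - grad ψ x) i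
    refine (norm_le_of_abs_apply_le hη0.le hd).trans (le_of_eq ?_)
    rw [hη]; field_simp

lemma IsTestFun.contDiff_one {φ : Space d → ℝ} (h : IsTestFun Ω φ) : ContDiff ℝ 1 φ :=
  h.smooth.of_le (by exact_mod_cast le_top)

lemma memLp_two_of_hasCompactSupport {E : Type*} [NormedAddCommGroup E] {f : Space d → E}
    (hf : Continuous f) (hc : HasCompactSupport f) : MemLp f 2 (vol Ω) :=
  (hf.memLp_of_hasCompactSupport (μ := volume) hc).restrict Ω

lemma hasCompactSupport_grad {ψ : Space d → ℝ} (hc : HasCompactSupport ψ) :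
    HasCompactSupport (grad ψ) :=
  HasCompactSupport.intro hc.isCompact fun _ hx => grad_eq_zero_of_notMem_tsupport hx

/-- In a set of finite measure, uniform convergence implies convergence in `L_2`. -/
lemma tendsto_eLpNorm_of_norm_le {E : Type*} [NormedAddCommGroup E] [IsFiniteMeasure (vol Ω)]
    {f : ℕ → Space d → E} {η : ℕ → ℝ} (hη : Tendsto η atTop (𝓝 0))
    (h : ∀ n x, ‖f n x‖ ≤ η n) : Tendsto (fun n => eLpNorm (f n) 2 (vol Ω)) atTop (𝓝 0) := by
  have h1 : Tendsto (fun n => vol Ω univ ^ (2 : ℝ≥0∞).toReal⁻¹ * ENNReal.ofReal (η n)) atTop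
      (𝓝 0) := by
    have := ENNReal.Tendsto.const_mul (a := vol Ω univ ^ (2 : ℝ≥0∞).toReal⁻¹)
      (ENNReal.tendsto_ofReal hη)
      (Or.inr (ENNReal.rpow_ne_top_of_nonneg (by positivity) (measure_ne_top _ _)))
    simpa using this
  exact tendsto_of_tendsto_of_tendsto_of_le_of_le tendsto_const_nhds h1 (fun _ => zero_le)
    fun n => eLpNorm_le_of_ae_bound (ae_of_all _ (h n))

lemma hasH10Grad_of_contDiff (hΩ : IsOpen Ω) [IsFiniteMeasure (vol Ω)] {ψ : Space d → ℝ}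
    (hψ : ContDiff ℝ 1 ψ) (hc : HasCompactSupport ψ) (hs : tsupport ψ ⊆ Ω) :
    HasH10Grad Ω ψ (grad ψ) := by
  refine ⟨memLp_two_of_hasCompactSupport hψ.continuous hc,
    memLp_two_of_hasCompactSupport (continuous_grad hψ) (hasCompactSupport_grad hc), ?_⟩
  choose φ hφ hφ' using fun n : ℕ =>
    exists_isTestFun_near hΩ hψ hc hs (Nat.one_div_pos_of_nat (α := ℝ) (n := n))
  exact ⟨φ, hφ,
    tendsto_eLpNorm_of_norm_le tendsto_one_div_add_atTop_nhds_zero_nat fun n x => (hφ' n x).1,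
    tendsto_eLpNorm_of_norm_le tendsto_one_div_add_atTop_nhds_zero_nat fun n x => (hφ' n x).2⟩

lemma IsTestFun.hasH10Grad {φ : Space d → ℝ} (h : IsTestFun Ω φ) : HasH10Grad Ω φ (grad φ) :=
  ⟨memLp_two_of_hasCompactSupport h.contDiff_one.continuous h.compact,
    memLp_two_of_hasCompactSupport (continuous_grad h.contDiff_one)
      (hasCompactSupport_grad h.compact), fun _ => φ, fun _ => h, by simp, by simp⟩

/-- `H^1_0(Ω)` is closed under convergence in `H^1(Ω)`. -/
lemma HasH10Grad.of_tendsto {v : Space d → ℝ} {G : Space d → Space d}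
    {vn : ℕ → Space d → ℝ} {Gn : ℕ → Space d → Space d} (h : ∀ n, HasH10Grad Ω (vn n) (Gn n))
    (hv : MemLp v 2 (vol Ω)) (hG : MemLp G 2 (vol Ω))
    (hvn : Tendsto (fun n => eLpNorm (fun x => vn n x - v x) 2 (vol Ω)) atTop (𝓝 0))
    (hGn : Tendsto (fun n => eLpNorm (fun x => Gn n x - G x) 2 (vol Ω)) atTop (𝓝 0)) :
    HasH10Grad Ω v G := by
  have hex : ∀ n : ℕ, ∃ φ, IsTestFun Ω φ ∧
      eLpNorm (fun x => φ x - vn n x) 2 (vol Ω) ≤ ENNReal.ofReal (1 / ((n : ℝ) + 1)) ∧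
      eLpNorm (fun x => grad φ x - Gn n x) 2 (vol Ω) ≤ ENNReal.ofReal (1 / ((n : ℝ) + 1)) := by
    intro n
    obtain ⟨φ, hφ, h1, h2⟩ := (h n).approx
    have hpos : (0 : ℝ≥0∞) < ENNReal.ofReal (1 / ((n : ℝ) + 1)) :=
      ENNReal.ofReal_pos.2 Nat.one_div_pos_of_nat
    obtain ⟨k, hk1, hk2⟩ := ((h1.eventually_le_const hpos).and (h2.eventually_le_const hpos)).exists
    exact ⟨φ k, hφ k, hk1, hk2⟩
  choose φ hφ h1 h2 using hex
  have hz : Tendsto (fun n : ℕ => ENNReal.ofReal (1 / ((n : ℝ) + 1))) atTop (𝓝 0) := by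
    simpa using ENNReal.tendsto_ofReal (tendsto_one_div_add_atTop_nhds_zero_nat (𝕜 := ℝ))
  refine ⟨hv, hG, φ, hφ, ?_, ?_⟩
  · refine tendsto_of_tendsto_of_tendsto_of_le_of_le tendsto_const_nhds
      (by simpa only [zero_add] using hz.add hvn) (fun _ => zero_le) fun n => ?_
    have := eLpNorm_add_le (((hφ n).hasH10Grad.memLp.sub (h n).memLp).1)
      (((h n).memLp.sub hv).1) (p := 2) (by norm_num)
    simp only [sub_add_sub_cancel] at this
    exact this.trans (add_le_add (h1 n) le_rfl)
  · refine tendsto_of_tendsto_of_tendsto_of_le_of_le tendsto_const_nhds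
      (by simpa only [zero_add] using hz.add hGn) (fun _ => zero_le) fun n => ?_
    have := eLpNorm_add_le (((hφ n).hasH10Grad.memLp_grad.sub (h n).memLp_grad).1)
      (((h n).memLp_grad.sub hG).1) (p := 2) (by norm_num)
    simp only [sub_add_sub_cancel] at this
    exact this.trans (add_le_add (h2 n) le_rfl)

/-- Bounded pointwise convergence in a set of finite measure implies convergence in `L_2`. -/
lemma memLp_and_tendsto_of_bounded {E : Type*} [NormedAddCommGroup E] [IsFiniteMeasure (vol Ω)]
    {f : ℕ → Space d → E} {f₀ : Space d → E} {B : ℝ}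
    (hf : ∀ n, AEStronglyMeasurable (f n) (vol Ω)) (hB : ∀ n, ∀ᵐ x ∂vol Ω, ‖f n x‖ ≤ B)
    (hlim : ∀ᵐ x ∂vol Ω, Tendsto (fun n => f n x) atTop (𝓝 (f₀ x))) :
    MemLp f₀ 2 (vol Ω) ∧ Tendsto (fun n => eLpNorm (fun x => f n x - f₀ x) 2 (vol Ω)) atTop
      (𝓝 0) := by
  have hm : AEStronglyMeasurable f₀ (vol Ω) := aestronglyMeasurable_of_tendsto_ae _ hf hlim
  have hB' : ∀ᵐ x ∂vol Ω, ∀ n, ‖f n x‖ ≤ B := ae_all_iff.2 hB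
  have hB0 : ∀ᵐ x ∂vol Ω, ‖f₀ x‖ ≤ B := by
    filter_upwards [hB', hlim] with x h1 h2
    exact le_of_tendsto h2.norm (Eventually.of_forall h1)
  refine ⟨MemLp.of_bound hm B hB0, ?_⟩
  have h2 : (2 : ℝ≥0∞).toReal = 2 := by norm_num
  have hl : Tendsto (fun n => ∫⁻ x, ‖f n x - f₀ x‖ₑ ^ (2 : ℝ) ∂vol Ω) atTop
      (𝓝 (∫⁻ _, 0 ∂vol Ω)) := by
    refine tendsto_lintegral_of_dominated_convergence' (fun _ => ENNReal.ofReal (B + B) ^ (2 : ℝ))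
      (fun n => ((hf n).sub hm).enorm.pow_const _) (fun n => ?_) ?_ ?_
    · filter_upwards [hB n, hB0] with x h1 h3
      refine ENNReal.rpow_le_rpow ?_ (by norm_num)
      rw [← ofReal_norm]
      exact ENNReal.ofReal_le_ofReal ((norm_sub_le _ _).trans (add_le_add h1 h3))
    · rw [lintegral_const]
      exact ENNReal.mul_ne_top (ENNReal.rpow_ne_top_of_nonneg (by norm_num) ENNReal.ofReal_ne_top)
        (measure_ne_top _ _)
    · filter_upwards [hlim] with x hx
      have h3 : Tendsto (fun n => ‖f n x - f₀ x‖ₑ) atTop (𝓝 0) := by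
        have := (hx.sub_const (f₀ x)).enorm
        simpa using this
      have := (ENNReal.continuous_rpow_const (y := 2)).tendsto 0 |>.comp h3
      simpa [Function.comp_def] using this
  simp_rw [eLpNorm_eq_lintegral_rpow_enorm_toReal (p := 2) (by norm_num) (by norm_num), h2]
  have := (ENNReal.continuous_rpow_const (y := 1 / 2)).tendsto _ |>.comp hl
  simpa [Function.comp_def] using this

end Space

/-! ### The bilinear form -/

section Form

variable {d : ℕ} {Ω : Set (Space d)}

/-- The norm of `L_2(Ω)`, for functions that are not bundled. -/
noncomputable def l2norm {E : Type*} [NormedAddCommGroup E] (Ω : Set (Space d)) (f : Space d → E) :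
    ℝ :=
  (eLpNorm f 2 (vol Ω)).toReal

lemma l2norm_nonneg {E : Type*} [NormedAddCommGroup E] (f : Space d → E) : 0 ≤ l2norm Ω f :=
  ENNReal.toReal_nonneg

lemma l2norm_add_le {E : Type*} [NormedAddCommGroup E] {f h : Space d → E}
    (hf : MemLp f 2 (vol Ω)) (hh : MemLp h 2 (vol Ω)) :
    l2norm Ω (fun x => f x + h x) ≤ l2norm Ω f + l2norm Ω h := by
  unfold l2norm
  rw [← ENNReal.toReal_add hf.2.ne hh.2.ne]
  exact ENNReal.toReal_mono (ENNReal.add_ne_top.2 ⟨hf.2.ne, hh.2.ne⟩)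
    (eLpNorm_add_le hf.1 hh.1 (by norm_num))

lemma tendsto_l2norm {E : Type*} [NormedAddCommGroup E] {f : ℕ → Space d → E}
    (h : Tendsto (fun n => eLpNorm (f n) 2 (vol Ω)) atTop (𝓝 0)) :
    Tendsto (fun n => l2norm Ω (f n)) atTop (𝓝 0) := by
  simpa using! (ENNReal.tendsto_toReal ENNReal.zero_ne_top).comp h

lemma abs_integral_mul_le {f h : Space d → ℝ} (hf : MemLp f 2 (vol Ω)) (hh : MemLp h 2 (vol Ω)) :
    |∫ x in Ω, f x * h x| ≤ l2norm Ω f * l2norm Ω h := by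
  have h1 : inner ℝ (hf.toLp f) (hh.toLp h) = ∫ x in Ω, f x * h x := by
    rw [L2.inner_def]
    refine integral_congr_ae ?_
    filter_upwards [hf.coeFn_toLp, hh.coeFn_toLp] with x h1 h2
    rw [h1, h2]; simp [mul_comm]
  rw [← h1]
  refine (abs_real_inner_le_norm _ _).trans (le_of_eq ?_)
  rw [Lp.norm_toLp, Lp.norm_toLp]; rfl

lemma sq_l2norm {E : Type*} [NormedAddCommGroup E] {f : Space d → E} (hf : MemLp f 2 (vol Ω)) :
    l2norm Ω f ^ 2 = ∫ x in Ω, ‖f x‖ ^ 2 := by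
  unfold l2norm
  rw [hf.eLpNorm_eq_integral_rpow_norm (by norm_num) (by norm_num)]
  have h2 : (2 : ℝ≥0∞).toReal = 2 := by norm_num
  have h0 : 0 ≤ ∫ x in Ω, ‖f x‖ ^ 2 := integral_nonneg fun x => by positivity
  simp only [h2, Real.rpow_ofNat]
  rw [ENNReal.toReal_ofReal (by positivity), ← Real.rpow_natCast, ← Real.rpow_mul h0]
  norm_num

lemma memLp_apply {G : Space d → Space d} (hG : MemLp G 2 (vol Ω)) (i : Fin d) :
    AEStronglyMeasurable (fun x => G x i) (vol Ω) :=
  (PiLp.continuous_apply 2 _ i).comp_aestronglyMeasurable hG.1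

namespace SpatialOperator

/-- The integrand of the bilinear form `L.form`. -/
def formDensity (L : SpatialOperator d) (t : ℝ) (v : Space d → ℝ) (G : Space d → Space d)
    (φ : Space d → ℝ) (Φ : Space d → Space d) (x : Space d) : ℝ :=
  (∑ i, ∑ j, L.a t x i j * G x j * Φ x i) + (∑ i, L.b t x i * G x i) * φ x + L.c t x * v x * φ x

variable {L : SpatialOperator d} {T t : ℝ} {v w φ χ : Space d → ℝ} {G H Φ X : Space d → Space d}

lemma form_eq : L.form Ω t v G φ Φ = ∫ x in Ω, L.formDensity t v G φ Φ x := rfl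

lemma abs_formDensity_le {M : ℝ} {x : Space d} (hM : (∀ i j, |L.a t x i j| ≤ M) ∧
    (∀ i, |L.b t x i| ≤ M) ∧ |L.c t x| ≤ M) :
    |L.formDensity t v G φ Φ x|
      ≤ ((d * d + d + 1) * M) * ((‖G x‖ + ‖v x‖) * (‖Φ x‖ + ‖φ x‖)) := by
  obtain ⟨h1, h2, h3⟩ := hM
  have hM0 : 0 ≤ M := (abs_nonneg _).trans h3
  have hG : ∀ i, |G x i| ≤ ‖G x‖ := fun i => PiLp.norm_apply_le (G x) i
  have hΦ : ∀ i, |Φ x i| ≤ ‖Φ x‖ := fun i => PiLp.norm_apply_le (Φ x) i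
  have e1 : |∑ i, ∑ j, L.a t x i j * G x j * Φ x i| ≤ d * d * (M * ‖G x‖ * ‖Φ x‖) := by
    calc _ ≤ ∑ i : Fin d, ∑ j : Fin d, M * ‖G x‖ * ‖Φ x‖ := by
          refine (Finset.abs_sum_le_sum_abs _ _).trans (Finset.sum_le_sum fun i _ =>
            (Finset.abs_sum_le_sum_abs _ _).trans (Finset.sum_le_sum fun j _ => ?_))
          rw [abs_mul, abs_mul]
          exact mul_le_mul (mul_le_mul (h1 i j) (hG j) (abs_nonneg _) hM0) (hΦ i) (abs_nonneg _)
            (by positivity)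
      _ = _ := by simp; ring
  have e2 : |∑ i, L.b t x i * G x i| ≤ d * (M * ‖G x‖) := by
    calc _ ≤ ∑ i : Fin d, M * ‖G x‖ := by
          refine (Finset.abs_sum_le_sum_abs _ _).trans (Finset.sum_le_sum fun i _ => ?_)
          rw [abs_mul]
          exact mul_le_mul (h2 i) (hG i) (abs_nonneg _) hM0
      _ = _ := by simp
  have e3 : |(∑ i, L.b t x i * G x i) * φ x| ≤ d * (M * ‖G x‖) * ‖φ x‖ := by
    rw [abs_mul]; exact mul_le_mul_of_nonneg_right e2 (abs_nonneg _)
  have e4 : |L.c t x * v x * φ x| ≤ M * ‖v x‖ * ‖φ x‖ := by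
    rw [abs_mul, abs_mul]
    exact mul_le_mul_of_nonneg_right (mul_le_mul_of_nonneg_right h3 (abs_nonneg _)) (abs_nonneg _)
  have hd : (0 : ℝ) ≤ d := Nat.cast_nonneg d
  have := abs_add_three (∑ i, ∑ j, L.a t x i j * G x j * Φ x i)
    ((∑ i, L.b t x i * G x i) * φ x) (L.c t x * v x * φ x)
  refine (this.trans (add_le_add (add_le_add e1 e3) e4)).trans ?_
  have p1 : 0 ≤ M * ‖G x‖ * ‖Φ x‖ := by positivity
  have p2 : 0 ≤ M * ‖G x‖ * ‖φ x‖ := by positivity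
  have p3 : 0 ≤ M * ‖v x‖ * ‖φ x‖ := by positivity
  have p4 : 0 ≤ M * ‖v x‖ * ‖Φ x‖ := by positivity
  have hdd : 0 ≤ (d : ℝ) * d := by positivity
  nlinarith [mul_nonneg hdd p2, mul_nonneg hdd p3, mul_nonneg hdd p4, mul_nonneg hd p1,
    mul_nonneg hd p3, mul_nonneg hd p4]

lemma IsElliptic.aestronglyMeasurable_formDensity (hL : L.IsElliptic Ω T) (hΩ : IsOpen Ω)
    (ht : t ∈ Ioc 0 T) (hv : MemLp v 2 (vol Ω)) (hG : MemLp G 2 (vol Ω)) (hφ : MemLp φ 2 (vol Ω))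
    (hΦ : MemLp Φ 2 (vol Ω)) : AEStronglyMeasurable (L.formDensity t v G φ Φ) (vol Ω) := by
  refine AEStronglyMeasurable.add (AEStronglyMeasurable.add ?_ ?_) ?_
  · refine Finset.aestronglyMeasurable_fun_sum _ fun i _ =>
      Finset.aestronglyMeasurable_fun_sum _ fun j _ => ?_
    exact (((hL.contDiffOn_a t ht i j).continuousOn.aestronglyMeasurable hΩ.measurableSet).mul
      (memLp_apply hG j)).mul (memLp_apply hΦ i)
  · exact (Finset.aestronglyMeasurable_fun_sum _ fun i _ =>
      (hL.measurable_b t ht i).mul (memLp_apply hG i)).mul hφ.1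
  · exact ((hL.measurable_c t ht).mul hv.1).mul hφ.1

lemma memLp_norm_add (hv : MemLp v 2 (vol Ω)) (hG : MemLp G 2 (vol Ω)) :
    MemLp (fun x => ‖G x‖ + ‖v x‖) 2 (vol Ω) := hG.norm.add hv.norm

lemma IsElliptic.integrable_formDensity (hL : L.IsElliptic Ω T) (hΩ : IsOpen Ω)
    (ht : t ∈ Ioc 0 T) (hv : MemLp v 2 (vol Ω)) (hG : MemLp G 2 (vol Ω)) (hφ : MemLp φ 2 (vol Ω))
    (hΦ : MemLp Φ 2 (vol Ω)) : Integrable (L.formDensity t v G φ Φ) (vol Ω) := by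
  obtain ⟨M, hM⟩ := hL.bounded t ht
  refine Integrable.mono' (((memLp_norm_add hv hG).integrable_mul (memLp_norm_add hφ hΦ)).const_mul
    ((d * d + d + 1) * M)) (hL.aestronglyMeasurable_formDensity hΩ ht hv hG hφ hΦ) ?_
  exact ae_restrict_of_forall_mem hΩ.measurableSet fun x hx => abs_formDensity_le (hM x hx)

/-- Boundedness of the bilinear form on `H^1(Ω)`. -/
lemma IsElliptic.exists_form_bound (hL : L.IsElliptic Ω T) (hΩ : IsOpen Ω) (ht : t ∈ Ioc 0 T) :
    ∃ C : ℝ, 0 ≤ C ∧ ∀ (v : Space d → ℝ) (G : Space d → Space d) (φ : Space d → ℝ)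
      (Φ : Space d → Space d), MemLp v 2 (vol Ω) → MemLp G 2 (vol Ω) → MemLp φ 2 (vol Ω) →
      MemLp Φ 2 (vol Ω) →
      |L.form Ω t v G φ Φ| ≤ C * ((l2norm Ω G + l2norm Ω v) * (l2norm Ω Φ + l2norm Ω φ)) := by
  obtain ⟨M, hM⟩ := hL.bounded t ht
  refine ⟨(d * d + d + 1) * |M|, by positivity, fun v G φ Φ hv hG hφ hΦ => ?_⟩
  have hn1 := memLp_norm_add hv hG
  have hn2 := memLp_norm_add hφ hΦ
  have h0 : |L.form Ω t v G φ Φ| ≤ ∫ x in Ω, ((d * d + d + 1) * |M|) *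
      ((‖G x‖ + ‖v x‖) * (‖Φ x‖ + ‖φ x‖)) := by
    rw [form_eq]
    refine (abs_integral_le_integral_abs).trans (integral_mono_ae
      (hL.integrable_formDensity hΩ ht hv hG hφ hΦ).abs
      ((hn1.integrable_mul hn2).const_mul _) ?_)
    refine ae_restrict_of_forall_mem hΩ.measurableSet fun x hx => ?_
    refine abs_formDensity_le ⟨fun i j => ((hM x hx).1 i j).trans (le_abs_self _),
      fun i => ((hM x hx).2.1 i).trans (le_abs_self _), ((hM x hx).2.2).trans (le_abs_self _)⟩
  have hnorm : ∀ (v : Space d → ℝ) (G : Space d → Space d), MemLp v 2 (vol Ω) →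
      MemLp G 2 (vol Ω) → l2norm Ω (fun x => ‖G x‖ + ‖v x‖) ≤ l2norm Ω G + l2norm Ω v := by
    intro v G hv hG
    refine (l2norm_add_le hG.norm hv.norm).trans (le_of_eq ?_)
    simp only [l2norm, eLpNorm_norm]
  rw [integral_const_mul] at h0
  refine h0.trans (mul_le_mul_of_nonneg_left ?_ (by positivity))
  refine (le_abs_self _).trans ((abs_integral_mul_le hn1 hn2).trans ?_)
  exact mul_le_mul (hnorm v G hv hG) (hnorm φ Φ hφ hΦ) (l2norm_nonneg _)
    (add_nonneg (l2norm_nonneg _) (l2norm_nonneg _))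

lemma IsElliptic.form_sub_left (hL : L.IsElliptic Ω T) (hΩ : IsOpen Ω)
    (ht : t ∈ Ioc 0 T) (hv : MemLp v 2 (vol Ω)) (hG : MemLp G 2 (vol Ω))
    (hw : MemLp w 2 (vol Ω)) (hH : MemLp H 2 (vol Ω)) (hφ : MemLp φ 2 (vol Ω))
    (hΦ : MemLp Φ 2 (vol Ω)) :
    L.form Ω t (fun x => v x - w x) (fun x => G x - H x) φ Φ
      = L.form Ω t v G φ Φ - L.form Ω t w H φ Φ := by
  simp only [form_eq]
  rw [← integral_sub (hL.integrable_formDensity hΩ ht hv hG hφ hΦ)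
    (hL.integrable_formDensity hΩ ht hw hH hφ hΦ)]
  congr 1; ext x
  simp only [formDensity, PiLp.sub_apply, mul_sub, sub_mul, Finset.sum_sub_distrib]
  ring

lemma IsElliptic.form_sub_right (hL : L.IsElliptic Ω T) (hΩ : IsOpen Ω)
    (ht : t ∈ Ioc 0 T) (hv : MemLp v 2 (vol Ω)) (hG : MemLp G 2 (vol Ω))
    (hφ : MemLp φ 2 (vol Ω)) (hΦ : MemLp Φ 2 (vol Ω)) (hχ : MemLp χ 2 (vol Ω))
    (hX : MemLp X 2 (vol Ω)) :
    L.form Ω t v G (fun x => φ x - χ x) (fun x => Φ x - X x)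
      = L.form Ω t v G φ Φ - L.form Ω t v G χ X := by
  simp only [form_eq]
  rw [← integral_sub (hL.integrable_formDensity hΩ ht hv hG hφ hΦ)
    (hL.integrable_formDensity hΩ ht hv hG hχ hX)]
  congr 1; ext x
  simp only [formDensity, PiLp.sub_apply, mul_sub, Finset.sum_sub_distrib]
  ring

lemma IsElliptic.tendsto_form (hL : L.IsElliptic Ω T) (hΩ : IsOpen Ω)
    (ht : t ∈ Ioc 0 T) (hv : MemLp v 2 (vol Ω)) (hG : MemLp G 2 (vol Ω))
    (hφ : MemLp φ 2 (vol Ω)) (hΦ : MemLp Φ 2 (vol Ω)) {φn : ℕ → Space d → ℝ}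
    {Φn : ℕ → Space d → Space d} (hφn : ∀ n, MemLp (φn n) 2 (vol Ω))
    (hΦn : ∀ n, MemLp (Φn n) 2 (vol Ω))
    (h1 : Tendsto (fun n => eLpNorm (fun x => φn n x - φ x) 2 (vol Ω)) atTop (𝓝 0))
    (h2 : Tendsto (fun n => eLpNorm (fun x => Φn n x - Φ x) 2 (vol Ω)) atTop (𝓝 0)) :
    Tendsto (fun n => L.form Ω t v G (φn n) (Φn n)) atTop (𝓝 (L.form Ω t v G φ Φ)) := by
  obtain ⟨C, hC, hb⟩ := hL.exists_form_bound hΩ ht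
  rw [tendsto_iff_norm_sub_tendsto_zero]
  have hz : Tendsto (fun n => C * ((l2norm Ω G + l2norm Ω v) *
      (l2norm Ω (fun x => Φn n x - Φ x) + l2norm Ω (fun x => φn n x - φ x)))) atTop (𝓝 0) := by
    simpa using (((tendsto_l2norm h2).add (tendsto_l2norm h1)).const_mul
      (l2norm Ω G + l2norm Ω v)).const_mul C
  refine squeeze_zero (fun _ => norm_nonneg _) (fun n => ?_) hz
  rw [← hL.form_sub_right hΩ ht hv hG (hφn n) (hΦn n) hφ hΦ]
  exact hb _ _ _ _ hv hG ((hφn n).sub hφ) ((hΦn n).sub hΦ)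

end SpatialOperator

lemma tendsto_integral_mul {D φ : Space d → ℝ} {φn : ℕ → Space d → ℝ} (hD : MemLp D 2 (vol Ω))
    (hφ : MemLp φ 2 (vol Ω)) (hφn : ∀ n, MemLp (φn n) 2 (vol Ω))
    (h : Tendsto (fun n => eLpNorm (fun x => φn n x - φ x) 2 (vol Ω)) atTop (𝓝 0)) :
    Tendsto (fun n => ∫ x in Ω, D x * φn n x) atTop (𝓝 (∫ x in Ω, D x * φ x)) := by
  rw [tendsto_iff_norm_sub_tendsto_zero]
  have hz : Tendsto (fun n => l2norm Ω D * l2norm Ω (fun x => φn n x - φ x)) atTop (𝓝 0) := by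
    simpa using (tendsto_l2norm h).const_mul (l2norm Ω D)
  refine squeeze_zero (fun _ => norm_nonneg _) (fun n => ?_) hz
  have := abs_integral_mul_le hD ((hφn n).sub hφ)
  have e : ∫ x in Ω, D x * φn n x - D x * φ x
      = (∫ x in Ω, D x * φn n x) - ∫ x in Ω, D x * φ x :=
    integral_sub (hD.integrable_mul (hφn n)) (hD.integrable_mul hφ)
  rw [← e]
  simpa only [mul_sub, Pi.sub_apply, Real.norm_eq_abs] using! this

/-- The weak form of an elliptic equation with data in `L_2(Ω)` may be tested with all of
`H^1_0(Ω)`. -/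
lemma SpatialOperator.IsElliptic.weak_form_h10 {L : SpatialOperator d} {T t : ℝ}
    (hL : L.IsElliptic Ω T) (hΩ : IsOpen Ω) (ht : t ∈ Ioc 0 T) {V D R : Space d → ℝ}
    {G : Space d → Space d} (hV : MemLp V 2 (vol Ω)) (hG : MemLp G 2 (vol Ω))
    (hD : MemLp D 2 (vol Ω)) (hR : MemLp R 2 (vol Ω))
    (heq : ∀ φ, IsTestFun Ω φ →
      (∫ x in Ω, D x * φ x) + L.form Ω t V G φ (grad φ) = ∫ x in Ω, R x * φ x)
    {φ : Space d → ℝ} {Φ : Space d → Space d} (h : HasH10Grad Ω φ Φ) :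
    (∫ x in Ω, D x * φ x) + L.form Ω t V G φ Φ = ∫ x in Ω, R x * φ x := by
  obtain ⟨φn, hφn, h1, h2⟩ := h.approx
  have m1 := fun n => (hφn n).hasH10Grad.memLp
  have m2 := fun n => (hφn n).hasH10Grad.memLp_grad
  refine tendsto_nhds_unique ((tendsto_integral_mul hD h.memLp m1 h1).add
    (hL.tendsto_form hΩ ht hV hG h.memLp h.memLp_grad m1 m2 h1 h2)) ?_
  simp_rw [heq _ (hφn _)]
  exact tendsto_integral_mul hR h.memLp m1 h1

end Form

/-! ### Regularized positive part and Green's formula -/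

section Truncation

/-- A `C^1` regularization of the positive part, equal to it in the limit `δ → 0`. -/
noncomputable def smoothPos (δ s : ℝ) : ℝ := √((max s 0) ^ 2 + δ ^ 2) - δ

/-- The derivative of `smoothPos δ`. -/
noncomputable def smoothPosDeriv (δ s : ℝ) : ℝ := max s 0 / √((max s 0) ^ 2 + δ ^ 2)

lemma hasDerivAt_sq_max (s : ℝ) : HasDerivAt (fun s : ℝ => (max s 0) ^ 2) (2 * max s 0) s := by
  rcases lt_trichotomy s 0 with h | rfl | h
  · rw [max_eq_right h.le, mul_zero]
    refine (hasDerivAt_const s (0 : ℝ)).congr_of_eventuallyEq ?_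
    filter_upwards [Iio_mem_nhds h] with r hr
    simp [max_eq_right (le_of_lt (mem_Iio.1 hr))]
  · rw [hasDerivAt_iff_isLittleO_nhds_zero]
    simp only [zero_add, max_self, mul_zero, smul_zero, sub_zero, ne_eq, OfNat.ofNat_ne_zero,
      not_false_eq_true, zero_pow]
    have h2 : (fun h : ℝ => h ^ 2) =o[𝓝 0] fun h => h := by
      simpa using Asymptotics.isLittleO_pow_pow (𝕜 := ℝ) (m := 1) (n := 2) (by norm_num)
    refine Asymptotics.IsBigO.trans_isLittleO (Asymptotics.IsBigO.of_bound 1 ?_) h2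
    refine Eventually.of_forall fun r => ?_
    rw [one_mul, Real.norm_of_nonneg (by positivity), Real.norm_of_nonneg (by positivity)]
    rcases le_total r 0 with hr | hr
    · rw [max_eq_right hr]; simpa using sq_nonneg r
    · rw [max_eq_left hr]
  · rw [max_eq_left h.le]
    have := hasDerivAt_pow 2 s
    refine (this.congr_deriv (by simp)).congr_of_eventuallyEq ?_
    filter_upwards [Ioi_mem_nhds h] with r hr
    simp [max_eq_left (le_of_lt (mem_Ioi.1 hr))]

lemma hasDerivAt_smoothPos {δ : ℝ} (hδ : 0 < δ) (s : ℝ) :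
    HasDerivAt (smoothPos δ) (smoothPosDeriv δ s) s := by
  have hne : (max s 0) ^ 2 + δ ^ 2 ≠ 0 := by positivity
  refine ((((hasDerivAt_sq_max s).add_const (δ ^ 2)).sqrt hne).sub_const δ).congr_deriv ?_
  rw [smoothPosDeriv, mul_div_mul_left _ _ two_ne_zero]

lemma contDiff_smoothPos {δ : ℝ} (hδ : 0 < δ) : ContDiff ℝ 1 (smoothPos δ) := by
  rw [contDiff_one_iff_deriv]
  refine ⟨fun s => (hasDerivAt_smoothPos hδ s).differentiableAt, ?_⟩
  rw [show deriv (smoothPos δ) = smoothPosDeriv δ from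
    funext fun s => (hasDerivAt_smoothPos hδ s).deriv]
  have h1 : Continuous fun s : ℝ => max s 0 := continuous_id.max continuous_const
  exact h1.div ((h1.pow 2).add continuous_const).sqrt fun s => (by positivity)

lemma smoothPos_of_nonpos {δ s : ℝ} (hδ : 0 ≤ δ) (hs : s ≤ 0) : smoothPos δ s = 0 := by
  simp [smoothPos, max_eq_right hs, Real.sqrt_sq hδ]

lemma smoothPosDeriv_of_nonpos {δ s : ℝ} (hs : s ≤ 0) : smoothPosDeriv δ s = 0 := by
  simp [smoothPosDeriv, max_eq_right hs]

lemma smoothPos_nonneg {δ s : ℝ} : 0 ≤ smoothPos δ s := by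
  rw [smoothPos, sub_nonneg]
  exact Real.le_sqrt_of_sq_le (by nlinarith [sq_nonneg (max s 0)])

lemma smoothPos_le {δ s : ℝ} (hδ : 0 ≤ δ) : smoothPos δ s ≤ max s 0 := by
  rw [smoothPos, sub_le_iff_le_add]
  refine Real.sqrt_le_iff.2 ⟨by positivity, ?_⟩
  nlinarith [mul_nonneg (le_max_right s 0) hδ]

lemma abs_smoothPosDeriv_le {δ s : ℝ} : |smoothPosDeriv δ s| ≤ 1 := by
  have h0 : 0 ≤ max s 0 := le_max_right _ _
  rw [smoothPosDeriv, abs_of_nonneg (by positivity)]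
  refine div_le_one_of_le₀ (Real.le_sqrt_of_sq_le ?_) (Real.sqrt_nonneg _)
  nlinarith [sq_nonneg δ]

lemma tendsto_smoothPos {δ : ℕ → ℝ} (hδ : Tendsto δ atTop (𝓝 0)) (s : ℝ) :
    Tendsto (fun n => smoothPos (δ n) s) atTop (𝓝 (max s 0)) := by
  have := ((hδ.pow 2).const_add ((max s 0) ^ 2)).sqrt.sub hδ
  simpa [smoothPos, Real.sqrt_sq (le_max_right s 0)] using this

lemma tendsto_smoothPosDeriv {δ : ℕ → ℝ} (hδ : Tendsto δ atTop (𝓝 0)) (s : ℝ) :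
    Tendsto (fun n => smoothPosDeriv (δ n) s) atTop (𝓝 (if 0 < s then 1 else 0)) := by
  split_ifs with h
  · have h1 := ((hδ.pow 2).const_add ((max s 0) ^ 2)).sqrt
    rw [max_eq_left h.le, zero_pow two_ne_zero, add_zero, Real.sqrt_sq h.le] at h1
    have := (tendsto_const_nhds (x := s)).div h1 h.ne'
    rw [div_self h.ne'] at this
    simpa only [smoothPosDeriv, max_eq_left h.le] using! this
  · simp only [smoothPosDeriv_of_nonpos (not_lt.1 h)]
    exact tendsto_const_nhds

variable {d : ℕ} {Ω : Set (Space d)}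

lemma contDiffOn_pderiv (hΩ : IsOpen Ω) {g : Space d → ℝ} (hg : ContDiffOn ℝ 2 g Ω) (i : Fin d) :
    ContDiffOn ℝ 1 (pderiv i g) Ω :=
  (hg.fderiv_of_isOpen hΩ (by norm_num)).clm_apply contDiffOn_const

/-- The divergence theorem for compactly supported functions. -/
lemma integral_pderiv_eq_zero {q : Space d → ℝ} (hq : ContDiff ℝ 1 q) (hc : HasCompactSupport q)
    (i : Fin d) : ∫ x, pderiv i q x = 0 := by
  have hci : Integrable (fun x => pderiv i q x) := by
    refine Continuous.integrable_of_hasCompactSupport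
      ((hq.continuous_fderiv one_ne_zero).clm_apply continuous_const) ?_
    exact (hc.fderiv_apply ℝ _)
  have := integral_mul_fderiv_eq_neg_fderiv_mul_of_integrable (μ := (volume : Measure (Space d)))
    (f := fun _ : Space d => (1 : ℝ)) (g := q) (v := EuclideanSpace.single i 1) (𝕜 := ℝ)
    (by simp) (by simpa only [one_mul] using! hci)
    (by simpa using hq.continuous.integrable_of_hasCompactSupport hc)
    (fun _ _ => by fun_prop) (fun x _ => hq.differentiable one_ne_zero x)
  simpa [pderiv] using this

lemma contDiff_mul_of_tsupport (hΩ : IsOpen Ω) {p ψ : Space d → ℝ} (hp : ContDiffOn ℝ 1 p Ω)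
    (hψ : ContDiff ℝ 1 ψ) (hs : tsupport ψ ⊆ Ω) : ContDiff ℝ 1 (fun x => p x * ψ x) := by
  rw [contDiff_iff_contDiffAt]
  intro x
  by_cases hx : x ∈ Ω
  · exact (hp.contDiffAt (hΩ.mem_nhds hx)).mul hψ.contDiffAt
  · have h0 : (fun x => p x * ψ x) =ᶠ[𝓝 x] fun _ => 0 := by
      filter_upwards [(isClosed_tsupport ψ).isOpen_compl.mem_nhds fun h => hx (hs h)] with y hy
      rw [image_eq_zero_of_notMem_tsupport hy, mul_zero]
    exact contDiffAt_const.congr_of_eventuallyEq h0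

/-- Green's formula. The functions `v` and `G` stand for `g` and its gradient, which need to agree
with them only on the support of `ψ`; this is how functions `g` whose gradient is not in `L_2(Ω)`
are admitted. -/
lemma SpatialOperator.IsElliptic.form_eq_integral_apply {L : SpatialOperator d} {T t : ℝ}
    (hL : L.IsElliptic Ω T) (hΩ : IsOpen Ω) (ht : t ∈ Ioc 0 T) {g v ψ : Space d → ℝ}
    {G : Space d → Space d} (hg : ContDiffOn ℝ 2 g Ω) (hψ : ContDiff ℝ 1 ψ)
    (hc : HasCompactSupport ψ) (hs : tsupport ψ ⊆ Ω) (hv : MemLp v 2 (vol Ω))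
    (hG : MemLp G 2 (vol Ω)) (hvg : ∀ x ∈ tsupport ψ, v x = g x)
    (hGg : ∀ x ∈ tsupport ψ, G x = grad g x) :
    Integrable (fun x => L.apply t g x * ψ x) (vol Ω) ∧
    L.form Ω t v G ψ (grad ψ) = ∫ x in Ω, L.apply t g x * ψ x := by
  set q : Fin d → Fin d → Space d → ℝ := fun i j x => (L.a t x i j * pderiv j g x) * ψ x with hq
  have hp : ∀ i j, ContDiffOn ℝ 1 (fun x => L.a t x i j * pderiv j g x) Ω := fun i j =>
    (hL.contDiffOn_a t ht i j).mul (contDiffOn_pderiv hΩ hg j)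
  have hqc : ∀ i j, ContDiff ℝ 1 (q i j) := fun i j => contDiff_mul_of_tsupport hΩ (hp i j) hψ hs
  have hqs : ∀ i j, HasCompactSupport (q i j) := fun i j => hc.mul_left
  have hqi : ∀ i j, Integrable (fun x => pderiv i (q i j) x) := fun i j =>
    Continuous.integrable_of_hasCompactSupport
      (((hqc i j).continuous_fderiv one_ne_zero).clm_apply continuous_const)
      ((hqs i j).fderiv_apply ℝ _)
  have hq0 : ∀ i j, ∀ x ∉ Ω, pderiv i (q i j) x = 0 := fun i j x hx => by
    have : x ∉ tsupport (q i j) := fun h => hx (hs (tsupport_mul_subset_right h))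
    rw [pderiv, fderiv_of_notMem_tsupport ℝ this]; simp
  have hsum0 : ∫ x in Ω, ∑ i, ∑ j, pderiv i (q i j) x = 0 := by
    rw [integral_finsetSum _ fun i _ => integrable_finsetSum _ fun j _ => (hqi i j).restrict]
    refine Finset.sum_eq_zero fun i _ => ?_
    rw [integral_finsetSum _ fun j _ => (hqi i j).restrict]
    refine Finset.sum_eq_zero fun j _ => ?_
    rw [setIntegral_eq_integral_of_forall_compl_eq_zero fun x hx => hq0 i j x hx]
    exact integral_pderiv_eq_zero (hqc i j) (hqs i j) i
  have hsumi : Integrable (fun x => ∑ i, ∑ j, pderiv i (q i j) x) (vol Ω) :=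
    integrable_finsetSum _ fun i _ => integrable_finsetSum _ fun j _ => (hqi i j).restrict
  have hpt : ∀ x ∈ Ω, L.formDensity t v G ψ (grad ψ) x - ∑ i, ∑ j, pderiv i (q i j) x
      = L.apply t g x * ψ x := by
    intro x hx
    by_cases hxs : x ∈ tsupport ψ
    · have hd : ∀ i j, pderiv i (q i j) x
          = L.a t x i j * pderiv j g x * pderiv i ψ x
            + pderiv i (fun y => L.a t y i j * pderiv j g y) x * ψ x := fun i j => by
        have h1 := ((hp i j).contDiffAt (hΩ.mem_nhds hx)).differentiableAt one_ne_zero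
        have h2 := (hψ.differentiable one_ne_zero) x
        have h3 : fderiv ℝ (q i j) x = _ := fderiv_fun_mul h1 h2
        have h4 : pderiv i (q i j) x
            = (L.a t x i j * pderiv j g x) * pderiv i ψ x
              + ψ x * pderiv i (fun y => L.a t y i j * pderiv j g y) x := by
          rw [pderiv, h3]; rfl
        rw [h4]; ring
      simp only [hd, formDensity, apply, hvg x hxs, hGg x hxs, grad_apply, Finset.sum_add_distrib,
        ← Finset.sum_mul]
      ring
    · have hd : ∀ i j, pderiv i (q i j) x = 0 := fun i j => by
        have : x ∉ tsupport (q i j) := fun h => hxs (tsupport_mul_subset_right h)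
        rw [pderiv, fderiv_of_notMem_tsupport ℝ this]; simp
      simp [hd, formDensity, image_eq_zero_of_notMem_tsupport hxs,
        grad_eq_zero_of_notMem_tsupport hxs]
  have hfi := hL.integrable_formDensity hΩ ht hv hG
    (memLp_two_of_hasCompactSupport hψ.continuous hc)
    (memLp_two_of_hasCompactSupport (continuous_grad hψ) (hasCompactSupport_grad hc))
  have hae : (fun x => L.formDensity t v G ψ (grad ψ) x - ∑ i, ∑ j, pderiv i (q i j) x)
      =ᵐ[vol Ω] fun x => L.apply t g x * ψ x := ae_restrict_of_forall_mem hΩ.measurableSet hpt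
  refine ⟨(hfi.sub hsumi).congr hae, ?_⟩
  rw [← integral_congr_ae hae, integral_sub hfi hsumi, hsum0, sub_zero, form_eq]

end Truncation

/-! ### Comparison for the elliptic operator -/

section Elliptic

variable {d : ℕ} {Ω : Set (Space d)}

/-- `(φ - c g)^+` is the `H^1`-limit of compactly supported `C^1` functions. -/
lemma exists_approx_truncation (hΩ : IsOpen Ω) [IsFiniteMeasure (vol Ω)] {φ g : Space d → ℝ}
    {c : ℝ} (hφ : IsTestFun Ω φ) (hg : ContDiffOn ℝ 2 g Ω) (hg0 : ∀ x, 0 < g x) (hc : 0 < c) :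
    ∃ ψ : ℕ → Space d → ℝ, (∀ n, ContDiff ℝ 1 (ψ n) ∧ HasCompactSupport (ψ n) ∧
        tsupport (ψ n) ⊆ tsupport φ ∧ ∀ x, 0 ≤ ψ n x) ∧
      MemLp (fun x => max (φ x - c * g x) 0) 2 (vol Ω) ∧
      MemLp (fun x => if 0 < φ x - c * g x then grad φ x - c • grad g x else 0) 2 (vol Ω) ∧
      Tendsto (fun n => eLpNorm (fun x => ψ n x - max (φ x - c * g x) 0) 2 (vol Ω)) atTop (𝓝 0) ∧
      Tendsto (fun n => eLpNorm (fun x => grad (ψ n) x -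
        if 0 < φ x - c * g x then grad φ x - c • grad g x else 0) 2 (vol Ω)) atTop (𝓝 0) := by
  set δ : ℕ → ℝ := fun n => 1 / ((n : ℝ) + 1) with hδdef
  have hδ0 : ∀ n, 0 < δ n := fun n => Nat.one_div_pos_of_nat
  have hδ : Tendsto δ atTop (𝓝 0) := tendsto_one_div_add_atTop_nhds_zero_nat
  set w : Space d → ℝ := fun x => φ x - c * g x with hw
  set ψ : ℕ → Space d → ℝ := fun n x => smoothPos (δ n) (w x) with hψdef
  have hwK : ∀ x, x ∉ tsupport φ → w x ≤ 0 := fun x hx => by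
    simp only [hw, image_eq_zero_of_notMem_tsupport hx]
    nlinarith [mul_pos hc (hg0 x)]
  have hsupp : ∀ n, tsupport (ψ n) ⊆ tsupport φ := fun n => by
    refine closure_minimal (fun x hx => ?_) (isClosed_tsupport φ)
    by_contra h
    exact hx (smoothPos_of_nonpos (hδ0 n).le (hwK x h))
  have hwc : ContDiffOn ℝ 1 w Ω :=
    hφ.contDiff_one.contDiffOn.sub (contDiffOn_const.mul (hg.of_le (by norm_num)))
  have hψc : ∀ n, ContDiff ℝ 1 (ψ n) := fun n => by
    rw [contDiff_iff_contDiffAt]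
    intro x
    by_cases hx : x ∈ Ω
    · exact (contDiff_smoothPos (hδ0 n)).contDiffAt.comp x (hwc.contDiffAt (hΩ.mem_nhds hx))
    · have h0 : ψ n =ᶠ[𝓝 x] fun _ => 0 := by
        filter_upwards [(isClosed_tsupport φ).isOpen_compl.mem_nhds fun h => hx (hφ.support h)]
          with y hy
        exact smoothPos_of_nonpos (hδ0 n).le (hwK y hy)
      exact contDiffAt_const.congr_of_eventuallyEq h0
  have hgrad : ∀ n, ∀ x ∈ Ω,
      grad (ψ n) x = smoothPosDeriv (δ n) (w x) • (grad φ x - c • grad g x) := by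
    intro n x hx
    have h1 : HasFDerivAt w (fderiv ℝ φ x - c • fderiv ℝ g x) x :=
      (hφ.contDiff_one.differentiable one_ne_zero x).hasFDerivAt.sub
        (((hg.contDiffAt (hΩ.mem_nhds hx)).differentiableAt (by norm_num)).hasFDerivAt.const_mul c)
    have h2 := (hasDerivAt_smoothPos (hδ0 n) (w x)).comp_hasFDerivAt x h1
    ext i
    have h3 : fderiv ℝ (ψ n) x = _ := h2.fderiv
    rw [grad_apply, pderiv, h3]
    simp [grad_apply, pderiv]
  -- all gradients are bounded by the gradient of `φ - c g` on the support of `φ`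
  obtain ⟨B₁, hB₁⟩ := hφ.contDiff_one.continuous.bounded_above_of_compact_support hφ.compact
  obtain ⟨B₂, hB₂⟩ := hφ.compact.isCompact.exists_bound_of_continuousOn
    (f := fun x => grad φ x - c • grad g x)
    (((continuous_grad hφ.contDiff_one).continuousOn.sub
      ((continuousOn_grad hΩ (hg.of_le (by norm_num))).const_smul c)).mono hφ.support)
  have hb1 : ∀ n x, ‖ψ n x‖ ≤ max B₁ 0 := fun n x => by
    rw [Real.norm_of_nonneg smoothPos_nonneg]
    refine (smoothPos_le (hδ0 n).le).trans (max_le_max ?_ le_rfl)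
    have := (le_abs_self (φ x)).trans (hB₁ x)
    simp only [hw]
    nlinarith [mul_pos hc (hg0 x)]
  have hb2 : ∀ n, ∀ x ∈ Ω, ‖grad (ψ n) x‖ ≤ max B₂ 0 := fun n x hx => by
    by_cases hxs : x ∈ tsupport φ
    · rw [hgrad n x hx, norm_smul]
      refine le_trans ?_ (le_max_left _ _)
      refine le_trans (mul_le_of_le_one_left (norm_nonneg _) abs_smoothPosDeriv_le) (hB₂ x hxs)
    · rw [grad_eq_zero_of_notMem_tsupport fun h => hxs (hsupp n h), norm_zero]
      exact le_max_right _ _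
  have hl1 := memLp_and_tendsto_of_bounded (Ω := Ω) (f := ψ) (f₀ := fun x => max (w x) 0)
    (fun n => (hψc n).continuous.aestronglyMeasurable) (fun n => ae_of_all _ (hb1 n))
    (ae_of_all _ fun x => tendsto_smoothPos hδ (w x))
  have hl2 := memLp_and_tendsto_of_bounded (Ω := Ω) (f := fun n => grad (ψ n))
    (f₀ := fun x => if 0 < w x then grad φ x - c • grad g x else 0)
    (fun n => (continuous_grad (hψc n)).aestronglyMeasurable)
    (fun n => ae_restrict_of_forall_mem hΩ.measurableSet (hb2 n))
    (ae_restrict_of_forall_mem hΩ.measurableSet fun x hx => by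
      simp only [hgrad _ x hx]
      have := (tendsto_smoothPosDeriv hδ (w x)).smul_const (grad φ x - c • grad g x)
      simpa only [ite_smul, one_smul, zero_smul] using this)
  exact ⟨ψ, fun n => ⟨hψc n, hφ.compact.of_isClosed_subset (isClosed_tsupport _) (hsupp n),
    hsupp n, fun x => smoothPos_nonneg⟩, hl1.1, hl2.1, hl1.2, hl2.2⟩

variable {L : SpatialOperator d} {T t : ℝ}

/-- The supersolution property of `g`, tested with the truncation `(φ - c g)^+`. -/
lemma SpatialOperator.IsElliptic.form_truncation (hL : L.IsElliptic Ω T) (hΩ : IsOpen Ω)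
    [IsFiniteMeasure (vol Ω)] (ht : t ∈ Ioc 0 T) {φ g : Space d → ℝ} {c lam : ℝ}
    (hφ : IsTestFun Ω φ) (hg : ContDiffOn ℝ 2 g Ω) (hg0 : ∀ x, 0 < g x)
    (hLg : ∀ x ∈ Ω, lam ≤ L.apply t g x) (hc : 0 < c) {ψ : Space d → ℝ} {Ψ : Space d → Space d}
    (hψ : ψ = fun x => max (φ x - c * g x) 0)
    (hΨ : Ψ = fun x => if 0 < φ x - c * g x then grad φ x - c • grad g x else 0) :
    HasH10Grad Ω ψ Ψ ∧
      c * lam * (∫ x in Ω, ψ x) + L.form Ω t ψ Ψ ψ Ψ ≤ L.form Ω t φ (grad φ) ψ Ψ := by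
  obtain ⟨ψn, hψn, m1, m2, h1, h2⟩ := exists_approx_truncation hΩ hφ hg hg0 hc
  simp only [← hψ, ← hΨ] at m1 m2
  have h1' : Tendsto (fun n => eLpNorm (fun x => ψn n x - ψ x) 2 (vol Ω)) atTop (𝓝 0) := by
    simpa only [hψ] using h1
  have h2' : Tendsto (fun n => eLpNorm (fun x => grad (ψn n) x - Ψ x) 2 (vol Ω)) atTop (𝓝 0) := by
    simpa only [hΨ] using h2
  have hH := fun n => hasH10Grad_of_contDiff hΩ (hψn n).1 (hψn n).2.1
    ((hψn n).2.2.1.trans hφ.support)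
  refine ⟨HasH10Grad.of_tendsto hH m1 m2 h1' h2', ?_⟩
  -- `g` and its gradient, cut off outside the support of `φ`
  set K := tsupport φ with hK
  have hKm : MeasurableSet K := (isClosed_tsupport φ).measurableSet
  have hcut : ∀ {E : Type} [NormedAddCommGroup E] {f : Space d → E}, ContinuousOn f Ω →
      MemLp (K.indicator f) 2 (vol Ω) := by
    intro E _ f hf
    obtain ⟨B, hB⟩ := hφ.compact.isCompact.exists_bound_of_continuousOn (hf.mono hφ.support)
    have hm : AEStronglyMeasurable (K.indicator f) (vol Ω) := by
      rw [aestronglyMeasurable_indicator_iff hKm]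
      exact ((hf.mono hφ.support).aestronglyMeasurable_of_isCompact hφ.compact.isCompact
        hKm).mono_measure (Measure.restrict_mono_measure Measure.restrict_le_self _)
    refine MemLp.of_bound hm (max B 0) (ae_of_all _ fun x => ?_)
    by_cases hx : x ∈ K
    · rw [indicator_of_mem hx]; exact (hB x hx).trans (le_max_left _ _)
    · rw [indicator_of_notMem hx, norm_zero]; exact le_max_right _ _
  have mg := hcut hg.continuousOn
  have mG := hcut (continuousOn_grad hΩ (hg.of_le (by norm_num)))
  have hgn : ∀ n, lam * ∫ x in Ω, ψn n x
      ≤ L.form Ω t (K.indicator g) (K.indicator (grad g)) (ψn n) (grad (ψn n)) := by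
    intro n
    obtain ⟨hi, he⟩ := hL.form_eq_integral_apply hΩ ht hg (hψn n).1 (hψn n).2.1
      ((hψn n).2.2.1.trans hφ.support) mg mG
      (fun x hx => indicator_of_mem ((hψn n).2.2.1 hx) _)
      (fun x hx => indicator_of_mem ((hψn n).2.2.1 hx) _)
    rw [he, ← integral_const_mul]
    refine integral_mono_ae ?_ hi (ae_restrict_of_forall_mem hΩ.measurableSet fun x hx => ?_)
    · exact (((hψn n).1.continuous.integrable_of_hasCompactSupport (hψn n).2.1).restrict).const_mul _
    · exact mul_le_mul_of_nonneg_right (hLg x hx) ((hψn n).2.2.2 x)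
  have hlim : lam * ∫ x in Ω, ψ x ≤ L.form Ω t (K.indicator g) (K.indicator (grad g)) ψ Ψ := by
    have h3 := tendsto_integral_mul (memLp_const (1 : ℝ)) m1 (fun n => (hH n).memLp) h1'
    simp only [one_mul] at h3
    exact le_of_tendsto_of_tendsto' (h3.const_mul lam)
      (hL.tendsto_form hΩ ht mg mG m1 m2 (fun n => (hH n).memLp) (fun n => (hH n).memLp_grad)
        h1' h2') hgn
  -- where `ψ` and `Ψ` do not vanish, `φ = ψ + c g` and `∇φ = Ψ + c ∇g`
  have hsplit : L.form Ω t φ (grad φ) ψ Ψ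
      = L.form Ω t ψ Ψ ψ Ψ + c * L.form Ω t (K.indicator g) (K.indicator (grad g)) ψ Ψ := by
    simp only [form_eq]
    rw [← integral_const_mul, ← integral_add (hL.integrable_formDensity hΩ ht m1 m2 m1 m2)
      ((hL.integrable_formDensity hΩ ht mg mG m1 m2).const_mul c)]
    congr 1; ext x
    by_cases hx : 0 < φ x - c * g x
    · have hxK : x ∈ K := by
        by_contra h
        rw [image_eq_zero_of_notMem_tsupport h] at hx
        nlinarith [mul_pos hc (hg0 x)]
      have e1 : ψ x = φ x - c * g x := by rw [hψ]; exact max_eq_left hx.le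
      have e2 : Ψ x = grad φ x - c • grad g x := by rw [hΨ]; exact if_pos hx
      have e3 : φ x = ψ x + c * g x := by rw [e1]; ring
      have e4 : ∀ i, grad φ x i = Ψ x i + c * grad g x i := fun i => by
        rw [e2]; simp
      simp only [formDensity, indicator_of_mem hxK, e3, e4, mul_add, add_mul,
        Finset.sum_add_distrib, Finset.mul_sum, Finset.sum_mul]
      simp only [mul_left_comm, mul_comm, mul_assoc]
      ring
    · have e1 : ψ x = 0 := by rw [hψ]; exact max_eq_right (not_lt.1 hx)
      have e2 : Ψ x = 0 := by rw [hΨ]; exact if_neg hx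
      simp [formDensity, e1, e2]
  rw [hsplit, mul_assoc]
  have := mul_le_mul_of_nonneg_left hlim hc.le
  linarith

/-- Gårding's inequality. -/
lemma SpatialOperator.IsElliptic.exists_garding (hL : L.IsElliptic Ω T) (hΩ : IsOpen Ω)
    (ht : t ∈ Ioc 0 T) : ∃ θ K : ℝ, 0 < θ ∧ 0 ≤ K ∧ ∀ (v : Space d → ℝ) (G : Space d → Space d),
      MemLp v 2 (vol Ω) → MemLp G 2 (vol Ω) →
      θ * l2norm Ω G ^ 2 - K * l2norm Ω v ^ 2 ≤ L.form Ω t v G v G := by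
  obtain ⟨M, hM⟩ := hL.bounded t ht
  obtain ⟨θ, hθ, hpos⟩ := hL.posDef t ht
  refine ⟨θ / 2, (d * |M|) ^ 2 / (2 * θ) + |M|, by positivity, by positivity,
    fun v G hv hG => ?_⟩
  rw [sq_l2norm hv, sq_l2norm hG, ← integral_const_mul, ← integral_const_mul, form_eq,
    ← integral_sub (((memLp_two_iff_integrable_sq_norm hG.1).1 hG).const_mul _)
      (((memLp_two_iff_integrable_sq_norm hv.1).1 hv).const_mul _)]
  refine integral_mono_ae ((((memLp_two_iff_integrable_sq_norm hG.1).1 hG).const_mul _).sub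
    (((memLp_two_iff_integrable_sq_norm hv.1).1 hv).const_mul _))
    (hL.integrable_formDensity hΩ ht hv hG hv hG)
    (ae_restrict_of_forall_mem hΩ.measurableSet fun x hx => ?_)
  have h1 : θ * ‖G x‖ ^ 2 ≤ ∑ i, ∑ j, L.a t x i j * G x j * G x i := by
    have := hpos x hx (G x)
    rwa [EuclideanSpace.real_norm_sq_eq]
  have h2 : |∑ i, L.b t x i * G x i| ≤ d * |M| * ‖G x‖ := by
    refine (Finset.abs_sum_le_sum_abs _ _).trans ?_
    calc ∑ i, |L.b t x i * G x i| ≤ ∑ _i : Fin d, |M| * ‖G x‖ :=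
          Finset.sum_le_sum fun i _ => by
            rw [abs_mul]
            exact mul_le_mul (((hM x hx).2.1 i).trans (le_abs_self M))
              (PiLp.norm_apply_le (G x) i) (abs_nonneg _) (abs_nonneg _)
      _ = d * |M| * ‖G x‖ := by simp; ring
  have h3 : -(d * |M| * ‖G x‖ * |v x|) ≤ (∑ i, L.b t x i * G x i) * v x := by
    refine neg_le_of_abs_le ?_
    rw [abs_mul]; exact mul_le_mul_of_nonneg_right h2 (abs_nonneg _)
  have h4 : -(|M| * |v x| ^ 2) ≤ L.c t x * v x * v x := by
    have := mul_le_mul_of_nonneg_right ((neg_abs_le (L.c t x)).trans' (neg_le_neg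
      ((hM x hx).2.2.trans (le_abs_self M)))) (sq_nonneg (v x))
    rw [sq_abs]; linarith
  -- Young's inequality for the first-order term
  have h5 : d * |M| * ‖G x‖ * |v x|
      ≤ θ / 2 * ‖G x‖ ^ 2 + (d * |M|) ^ 2 / (2 * θ) * |v x| ^ 2 := by
    have e : θ / 2 * ‖G x‖ ^ 2 + (d * |M|) ^ 2 / (2 * θ) * |v x| ^ 2 - d * |M| * ‖G x‖ * |v x|
        = (θ * ‖G x‖ - d * |M| * |v x|) ^ 2 / (2 * θ) := by field_simp; ring
    have : 0 ≤ (θ * ‖G x‖ - d * |M| * |v x|) ^ 2 / (2 * θ) := by positivity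
    linarith
  simp only [Real.norm_eq_abs, formDensity]
  linarith

lemma abs_l2norm_sub_le {f h : Space d → ℝ} (hf : MemLp f 2 (vol Ω)) (hh : MemLp h 2 (vol Ω)) :
    |l2norm Ω f - l2norm Ω h| ≤ l2norm Ω (fun x => f x - h x) := by
  have h1 := l2norm_add_le (hf.sub hh) hh
  have h2 := l2norm_add_le (hh.sub hf) hf
  have h3 : l2norm Ω (h - f) = l2norm Ω (f - h) := by
    unfold l2norm; rw [eLpNorm_sub_comm]
  simp only [Pi.sub_apply, sub_add_cancel] at h1 h2
  rw [h3] at h2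
  rw [abs_le]
  constructor
  · change -(l2norm Ω (f - h)) ≤ _; linarith
  · change _ ≤ l2norm Ω (f - h); linarith

/-- The elliptic part of the comparison principle: an `H^1_0`-solution `V` of `L V = R - D` is
compared with the supersolution `c g` by testing with `(V - c g)^+`. As `∇g` need not be
square-integrable, the test function is approximated by `(φ - c g)^+` with test functions `φ`
tending to `V`; Gårding's inequality bounds these in `H^1`, and then the error in the bilinear form
tends to zero. -/
lemma SpatialOperator.IsElliptic.comparison (hL : L.IsElliptic Ω T) (hΩ : IsOpen Ω)
    [IsFiniteMeasure (vol Ω)] (ht : t ∈ Ioc 0 T) {μ : ℝ} (hμ : L.LowerBound Ω T μ)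
    {g : Space d → ℝ} {c lam : ℝ} (hg : ContDiffOn ℝ 2 g Ω) (hg0 : ∀ x, 0 < g x)
    (hLg : ∀ x ∈ Ω, lam ≤ L.apply t g x) (hc : 0 < c) {V D R : Space d → ℝ} {G : Space d → Space d}
    (hV : HasH10Grad Ω V G) (hD : MemLp D 2 (vol Ω)) (hR : MemLp R 2 (vol Ω))
    (heq : ∀ φ, IsTestFun Ω φ →
      (∫ x in Ω, D x * φ x) + L.form Ω t V G φ (grad φ) = ∫ x in Ω, R x * φ x) {ψ : Space d → ℝ}
    (hψ : ψ = fun x => max (V x - c * g x) 0) (hψm : MemLp ψ 2 (vol Ω)) :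
    (∫ x in Ω, D x * ψ x) + μ * l2norm Ω ψ ^ 2 + c * lam * (∫ x in Ω, ψ x)
      ≤ ∫ x in Ω, R x * ψ x := by
  obtain ⟨C, hC, hb⟩ := hL.exists_form_bound hΩ ht
  obtain ⟨θ, K, hθ, hK, hgard⟩ := hL.exists_garding hΩ ht
  obtain ⟨φ, hφ, h1, h2⟩ := hV.approx
  have mφ := fun n => (hφ n).hasH10Grad.memLp
  have mΦ := fun n => (hφ n).hasH10Grad.memLp_grad
  set ψn : ℕ → Space d → ℝ := fun n x => max (φ n x - c * g x) 0 with hψn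
  set Ψn : ℕ → Space d → Space d := fun n x =>
    if 0 < φ n x - c * g x then grad (φ n) x - c • grad g x else 0 with hΨn
  have htr := fun n => hL.form_truncation hΩ ht (hφ n) hg hg0 hLg hc (ψ := ψn n) (Ψ := Ψn n) rfl rfl
  have mψ := fun n => (htr n).1.memLp
  have mΨ := fun n => (htr n).1.memLp_grad
  set η : ℕ → ℝ := fun n => l2norm Ω (fun x => grad (φ n) x - G x)
    + l2norm Ω (fun x => φ n x - V x) with hη
  have hη0 : Tendsto η atTop (𝓝 0) := by
    simpa using (tendsto_l2norm h2).add (tendsto_l2norm h1)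
  have hηnn : ∀ n, 0 ≤ η n := fun n => add_nonneg (l2norm_nonneg _) (l2norm_nonneg _)
  -- the truncations converge in `L_2`, as taking the positive part is a contraction
  have hψlim : Tendsto (fun n => eLpNorm (fun x => ψn n x - ψ x) 2 (vol Ω)) atTop (𝓝 0) := by
    refine tendsto_of_tendsto_of_tendsto_of_le_of_le tendsto_const_nhds h1 (fun _ => zero_le)
      fun n => eLpNorm_mono fun x => ?_
    rw [hψ]
    refine (abs_max_sub_max_le_abs _ _ _).trans (le_of_eq ?_)
    rw [Real.norm_eq_abs]; congr 1; ring
  have hnlim : Tendsto (fun n => l2norm Ω (ψn n)) atTop (𝓝 (l2norm Ω ψ)) := by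
    rw [tendsto_iff_norm_sub_tendsto_zero]
    exact squeeze_zero (fun _ => norm_nonneg _) (fun n => abs_l2norm_sub_le (mψ n) hψm)
      (tendsto_l2norm hψlim)
  have hDlim := tendsto_integral_mul hD hψm mψ hψlim
  have hRlim := tendsto_integral_mul hR hψm mψ hψlim
  have hIlim := tendsto_integral_mul (memLp_const (1 : ℝ)) hψm mψ hψlim
  simp only [one_mul] at hIlim
  have hmain : ∀ n, c * lam * (∫ x in Ω, ψn n x) + L.form Ω t (ψn n) (Ψn n) (ψn n) (Ψn n)
      ≤ (∫ x in Ω, R x * ψn n x) - (∫ x in Ω, D x * ψn n x)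
        + C * (η n * (l2norm Ω (Ψn n) + l2norm Ω (ψn n))) := by
    intro n
    have e1 := hL.weak_form_h10 hΩ ht hV.memLp hV.memLp_grad hD hR heq (htr n).1
    have e2 := hL.form_sub_left hΩ ht (mφ n) (mΦ n) hV.memLp hV.memLp_grad (mψ n) (mΨ n)
    have e3 := (le_abs_self _).trans (hb _ _ _ _ ((mφ n).sub hV.memLp)
      ((mΦ n).sub hV.memLp_grad) (mψ n) (mΨ n))
    have e4 := (htr n).2
    change L.form Ω t (fun x => φ n x - V x) (fun x => grad (φ n) x - G x) (ψn n) (Ψn n)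
      ≤ C * (η n * _) at e3
    linarith
  -- boundedness in `H^1`
  obtain ⟨b, hbb⟩ := hnlim.bddAbove_range
  obtain ⟨b₁, hb₁⟩ := hη0.bddAbove_range
  obtain ⟨P, hP⟩ := (((hRlim.sub hDlim).sub (hIlim.const_mul (c * lam)))).bddAbove_range
  have hbn : ∀ n, l2norm Ω (ψn n) ≤ b := fun n => hbb (mem_range_self n)
  have hηn : ∀ n, η n ≤ b₁ := fun n => hb₁ (mem_range_self n)
  have hPn : ∀ n, (∫ x in Ω, R x * ψn n x) - (∫ x in Ω, D x * ψn n x)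
      - c * lam * (∫ x in Ω, ψn n x) ≤ P := fun n => hP (mem_range_self n)
  have hb0 : 0 ≤ b := (l2norm_nonneg _).trans (hbn 0)
  have hb₁0 : 0 ≤ b₁ := (hηnn 0).trans (hηn 0)
  set Q : ℝ := |P| + K * b ^ 2 + C * (b₁ * b) with hQ
  have hQ0 : 0 ≤ Q := by positivity
  have hA : ∀ n, l2norm Ω (Ψn n) ≤ (Q + C * b₁) / θ + 1 := by
    intro n
    set A := l2norm Ω (Ψn n) with hAdef
    have hA0 : 0 ≤ A := l2norm_nonneg _
    have e1 := hgard _ _ (mψ n) (mΨ n)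
    have e2 : K * l2norm Ω (ψn n) ^ 2 ≤ K * b ^ 2 :=
      mul_le_mul_of_nonneg_left (pow_le_pow_left₀ (l2norm_nonneg _) (hbn n) 2) hK
    have e3 : C * (η n * (A + l2norm Ω (ψn n))) ≤ C * (b₁ * (A + b)) :=
      mul_le_mul_of_nonneg_left (mul_le_mul (hηn n) (by linarith [hbn n])
        (add_nonneg hA0 (l2norm_nonneg _)) hb₁0) hC
    have e4 : θ * A ^ 2 ≤ Q + C * b₁ * A := by
      have := hmain n
      have := hPn n
      have := le_abs_self P
      rw [hQ]; linarith
    rcases le_total A 1 with h | h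
    · have : 0 ≤ (Q + C * b₁) / θ := by positivity
      linarith
    · have : A ≤ (Q + C * b₁) / θ := by
        rw [le_div_iff₀ hθ]
        have hA1 : 0 < A := by linarith
        refine le_of_mul_le_mul_right ?_ hA1
        nlinarith
      linarith
  -- the lower bound `μ` of the form now replaces Gårding's inequality
  set A₀ := (Q + C * b₁) / θ + 1 with hA₀
  have hfin : ∀ n, (∫ x in Ω, D x * ψn n x) + μ * l2norm Ω (ψn n) ^ 2
      + c * lam * (∫ x in Ω, ψn n x) ≤ (∫ x in Ω, R x * ψn n x) + C * (η n * (A₀ + b)) := by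
    intro n
    have e1 := hμ t ht _ _ (htr n).1
    have e2 : ∫ x in Ω, ψn n x ^ 2 = l2norm Ω (ψn n) ^ 2 := by
      rw [sq_l2norm (mψ n)]; simp only [Real.norm_eq_abs, sq_abs]
    have e3 : C * (η n * (l2norm Ω (Ψn n) + l2norm Ω (ψn n))) ≤ C * (η n * (A₀ + b)) :=
      mul_le_mul_of_nonneg_left (mul_le_mul_of_nonneg_left (add_le_add (hA n) (hbn n)) (hηnn n)) hC
    rw [e2] at e1
    have := hmain n
    linarith
  have hl := (hDlim.add ((hnlim.pow 2).const_mul μ)).add (hIlim.const_mul (c * lam))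
  have hr := hRlim.add ((hη0.mul_const (A₀ + b)).const_mul C)
  rw [zero_mul, mul_zero, add_zero] at hr
  exact le_of_tendsto_of_tendsto' hl hr hfin

end Elliptic

/-! ### Comparison in time -/

section Comparison

variable {d : ℕ} {Ω : Set (Space d)}

lemma inner_eq_integral (f h : L2 Ω) : inner ℝ f h = ∫ x in Ω, f x * h x := by
  rw [L2.inner_def]
  refine integral_congr_ae (ae_of_all _ fun x => ?_)
  simp [mul_comm]

lemma inner_posPart_le (f h : L2 Ω) :
    inner ℝ (Lp.posPart f) h ≤ ‖Lp.posPart f‖ * ‖Lp.posPart h‖ := by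
  refine le_trans ?_ (real_inner_le_norm _ _)
  rw [inner_eq_integral, inner_eq_integral]
  refine integral_mono_ae ((Lp.memLp _).integrable_mul (Lp.memLp _))
    ((Lp.memLp _).integrable_mul (Lp.memLp _)) ?_
  filter_upwards [Lp.coeFn_posPart f, Lp.coeFn_posPart h] with x h1 h2
  simp only [h1, h2]
  exact mul_le_mul_of_nonneg_left (le_max_left _ _) (le_max_right _ _)

lemma inner_posPart_self (f : L2 Ω) : inner ℝ (Lp.posPart f) f = ‖Lp.posPart f‖ ^ 2 := by
  rw [← real_inner_self_eq_norm_sq, inner_eq_integral, inner_eq_integral]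
  refine integral_congr_ae ?_
  filter_upwards [Lp.coeFn_posPart f] with x h1
  rw [h1]
  rcases le_total (f x) 0 with h | h
  · simp [max_eq_right h]
  · simp [max_eq_left h]

lemma LinftyLE.ae_abs_le {r : Space d → ℝ} {K : ℝ} (h : LinftyLE Ω r K) :
    ∀ᵐ x ∂vol Ω, |r x| ≤ K := by
  have h1 := ae_le_eLpNormEssSup (f := r) (μ := vol Ω)
  filter_upwards [h1] with x hx
  rw [← eLpNorm_exponent_top] at hx
  have := ENNReal.toReal_mono h.1.2.ne hx
  rw [toReal_enorm, Real.norm_eq_abs] at this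
  exact this.trans h.2

lemma linftyLE_of_ae_abs_le {r : Space d → ℝ} {K : ℝ} (hr : AEStronglyMeasurable r (vol Ω))
    (hK : 0 ≤ K) (h : ∀ᵐ x ∂vol Ω, |r x| ≤ K) : LinftyLE Ω r K := by
  refine ⟨memLp_top_of_bound hr K h, ENNReal.toReal_le_of_le_ofReal hK ?_⟩
  simpa using eLpNorm_le_of_ae_bound (p := ∞) h

/-- `e` satisfies `D_t^α e + L e = R` in the sense of distributions at time `t`; both the Caputo
derivative and the spatial gradient are existentially quantified, as in `IsResidualAt`. -/
def IsWeakSolutionAt (Ω : Set (Space d)) (α : ℝ) (L : SpatialOperator d) (e : ℝ → L2 Ω) (t : ℝ)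
    (R : Space d → ℝ) : Prop :=
  ∃ (D : L2 Ω) (G : Space d → Space d), HasCaputoDeriv α e t D ∧ HasH10Grad Ω (e t) G ∧
    ∀ φ, IsTestFun Ω φ →
      (∫ x in Ω, D x * φ x) + L.form Ω t (e t) G φ (grad φ) = ∫ x in Ω, R x * φ x

lemma HasH10Grad.sub_ae {v w z : Space d → ℝ} {G H : Space d → Space d} (hv : HasH10Grad Ω v G)
    (hw : HasH10Grad Ω w H) (hz : z =ᵐ[vol Ω] fun x => v x - w x) :
    HasH10Grad Ω z fun x => G x - H x := by
  obtain ⟨φ, hφ, h1, h2⟩ := hv.approx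
  obtain ⟨χ, hχ, h3, h4⟩ := hw.approx
  have hgrad : ∀ n x, grad (fun x => φ n x - χ n x) x = grad (φ n) x - grad (χ n) x := by
    intro n x
    ext i
    rw [PiLp.sub_apply, grad_apply, grad_apply, grad_apply, pderiv,
      fderiv_fun_sub ((hφ n).contDiff_one.differentiable one_ne_zero x)
        ((hχ n).contDiff_one.differentiable one_ne_zero x)]
    rfl
  refine ⟨(hv.memLp.sub hw.memLp).ae_eq hz.symm, hv.memLp_grad.sub hw.memLp_grad,
    fun n x => φ n x - χ n x, fun n => ⟨(hφ n).smooth.sub (hχ n).smooth,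
      (hφ n).compact.sub (hχ n).compact, ?_⟩, ?_, ?_⟩
  · refine (tsupport_sub _ _).trans (union_subset (hφ n).support (hχ n).support)
  · refine tendsto_of_tendsto_of_tendsto_of_le_of_le tendsto_const_nhds
      (by simpa only [zero_add] using h1.add h3) (fun _ => zero_le) fun n => ?_
    have e : eLpNorm (fun x => φ n x - χ n x - z x) 2 (vol Ω)
        = eLpNorm ((fun x => φ n x - v x) - fun x => χ n x - w x) 2 (vol Ω) := by
      refine eLpNorm_congr_ae ?_
      filter_upwards [hz] with x hx
      simp only [Pi.sub_apply, hx]; ring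
    simp only
    rw [e]
    exact eLpNorm_sub_le ((hφ n).hasH10Grad.memLp.sub hv.memLp).1
      ((hχ n).hasH10Grad.memLp.sub hw.memLp).1 (by norm_num)
  · refine tendsto_of_tendsto_of_tendsto_of_le_of_le tendsto_const_nhds
      (by simpa only [zero_add] using h2.add h4) (fun _ => zero_le) fun n => ?_
    have e : (fun x => grad (fun x => φ n x - χ n x) x - (G x - H x))
        = (fun x => grad (φ n) x - G x) - fun x => grad (χ n) x - H x := by
      funext x
      rw [hgrad, Pi.sub_apply]
      exact sub_sub_sub_comm _ _ _ _
    rw [e]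
    exact eLpNorm_sub_le ((hφ n).hasH10Grad.memLp_grad.sub hv.memLp_grad).1
      ((hχ n).hasH10Grad.memLp_grad.sub hw.memLp_grad).1 (by norm_num)

variable {L : SpatialOperator d} {T α : ℝ}

/-- Two functions with the same right-hand side `f`: the residuals subtract. -/
lemma IsResidualAt.sub (hL : L.IsElliptic Ω T) (hΩ : IsOpen Ω) {t : ℝ}
    (ht : t ∈ Ioc 0 T) {f : ℝ → Space d → ℝ} {v w : ℝ → L2 Ω} {r q : Space d → ℝ}
    (hv : IsResidualAt Ω α L f v t r) (hw : IsResidualAt Ω α L f w t q)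
    (hr : MemLp r 2 (vol Ω)) (hq : MemLp q 2 (vol Ω)) :
    IsWeakSolutionAt Ω α L (fun s => v s - w s) t fun x => r x - q x := by
  obtain ⟨-, D, G, hD, hG, h1⟩ := hv
  obtain ⟨-, D', H, hD', hH, h2⟩ := hw
  refine ⟨D - D', fun x => G x - H x, hD.sub ht.1 hD', hG.sub_ae hH (Lp.coeFn_sub _ _),
    fun φ hφ => ?_⟩
  have m1 := hφ.hasH10Grad.memLp
  have m2 := hφ.hasH10Grad.memLp_grad
  have e1 : ∫ x in Ω, (D - D' : L2 Ω) x * φ x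
      = (∫ x in Ω, D x * φ x) - ∫ x in Ω, D' x * φ x := by
    refine Eq.trans (integral_congr_ae ?_)
      (integral_sub ((Lp.memLp D).integrable_mul m1) ((Lp.memLp D').integrable_mul m1))
    filter_upwards [Lp.coeFn_sub D D'] with x hx
    rw [hx, Pi.sub_apply]
    exact sub_mul _ _ _
  have e2 : ∫ x in Ω, (r x - q x) * φ x = (∫ x in Ω, r x * φ x) - ∫ x in Ω, q x * φ x := by
    simp only [sub_mul]
    exact integral_sub (hr.integrable_mul m1) (hq.integrable_mul m1)
  have e3 : L.form Ω t (v t - w t : L2 Ω) (fun x => G x - H x) φ (grad φ)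
      = L.form Ω t (v t) G φ (grad φ) - L.form Ω t (w t) H φ (grad φ) := by
    rw [← hL.form_sub_left hΩ ht (Lp.memLp _) hG.memLp_grad (Lp.memLp _) hH.memLp_grad m1 m2]
    simp only [SpatialOperator.form_eq]
    refine integral_congr_ae ?_
    filter_upwards [Lp.coeFn_sub (v t) (w t)] with x hx
    simp only [SpatialOperator.formDensity, hx, Pi.sub_apply]
  rw [e1, e2, e3]
  linarith [h1 φ hφ, h2 φ hφ]

/-- The comparison principle for the barrier `κ E(t) g(x)`, which is taken to vanish at time `0`.
The value `E 0` is the right limit, so that the barrier jumps at `t = 0`, and `ℰ t` is the Caputo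
derivative of `E` with this jump included. -/
theorem le_barrier (hΩ : IsOpen Ω) (hΩb : Bornology.IsBounded Ω) (hα : α ∈ Ioo (0 : ℝ) 1)
    (hL : L.IsElliptic Ω T) {μ : ℝ} (hμ : L.LowerBound Ω T μ) {lam B κ : ℝ} (hκ : 0 < κ)
    {g : Space d → ℝ} (hg : ContDiffOn ℝ 2 g Ω) (hg0 : ∀ x, 0 < g x)
    (hLg : ∀ t ∈ Ioc 0 T, ∀ x ∈ Ω, lam ≤ L.apply t g x) (hgB : ∀ x ∈ Ω, 1 ≤ g x ∧ g x ≤ B)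
    {E ℰ : ℝ → ℝ} (hEc : Continuous E) (hE0 : ∀ s, 0 < E s)
    (hE : ∀ t ∈ Ioc 0 T, 0 ≤ ℰ t ∧
      HasCaputoDeriv α E t (ℰ t - (Real.Gamma (1 - α))⁻¹ * t ^ (-α) * E 0))
    {e : ℝ → L2 Ω} (hec : ContinuousOn e (Icc 0 T)) (he0 : e 0 = 0) {R : ℝ → Space d → ℝ}
    (he : ∀ t ∈ Ioc 0 T, IsWeakSolutionAt Ω α L e t (R t))
    (hR : ∀ t ∈ Ioc 0 T, LinftyLE Ω (R t) (κ * (ℰ t + lam * E t))) :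
    ∀ t ∈ Icc 0 T, ∀ᵐ x ∂vol Ω, e t x ≤ κ * E t * g x := by
  have := isFiniteMeasure_vol hΩb
  have hΓ : 0 < Real.Gamma (1 - α) := Real.Gamma_pos_of_pos (by linarith [hα.2])
  have hgm : MemLp g 2 (vol Ω) := by
    refine MemLp.of_bound (hg.continuousOn.aestronglyMeasurable hΩ.measurableSet) B
      (ae_restrict_of_forall_mem hΩ.measurableSet fun x hx => ?_)
    rw [Real.norm_of_nonneg (hg0 x).le]; exact (hgB x hx).2
  set gL : L2 Ω := hgm.toLp g with hgL
  set w : ℝ → L2 Ω := fun t => e t - (κ * E t) • gL with hw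
  have hwae : ∀ t, Lp.posPart (w t) =ᵐ[vol Ω] fun x => max (e t x - κ * E t * g x) 0 := by
    intro t
    filter_upwards [Lp.coeFn_posPart (w t), Lp.coeFn_sub (e t) ((κ * E t) • gL),
      Lp.coeFn_smul (κ * E t) gL, hgm.coeFn_toLp] with x h1 h2 h3 h4
    rw [h1, h2, Pi.sub_apply, h3, Pi.smul_apply, h4, smul_eq_mul]
  set m : ℝ → ℝ := fun t => ‖Lp.posPart (w t)‖ with hm
  have hmnn : ∀ t, 0 ≤ m t := fun t => norm_nonneg _
  have hmc : ContinuousOn m (Icc 0 T) := by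
    refine (Lp.continuous_posPart.comp_continuousOn ?_).norm
    exact hec.sub ((continuous_const.mul hEc).smul continuous_const).continuousOn
  suffices hm0 : ∀ t ∈ Icc 0 T, m t = 0 by
    intro t ht
    have h1 : Lp.posPart (w t) = 0 := norm_eq_zero.1 (hm0 t ht)
    filter_upwards [hwae t, (h1 ▸ Lp.coeFn_zero ℝ 2 (vol Ω) :
      Lp.posPart (w t) =ᵐ[vol Ω] 0)] with x h2 h3
    rw [h3, Pi.zero_apply] at h2
    linarith [le_max_left (e t x - κ * E t * g x) 0]
  have hmz : m 0 = 0 := by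
    rw [hm]
    simp only [norm_eq_zero]
    refine Lp.ext ?_
    filter_upwards [hwae 0, Lp.coeFn_zero ℝ 2 (vol Ω),
      (he0 ▸ Lp.coeFn_zero ℝ 2 (vol Ω) : e 0 =ᵐ[vol Ω] 0)] with x h1 h2 h3
    rw [h1, h2, h3]
    simp only [Pi.zero_apply, zero_sub]
    exact max_eq_right (neg_nonpos.2 (by have := hg0 x; have := hE0 0; positivity))
  -- the inequality for the error at a time where `m` is positive
  have hell : ∀ t ∈ Ioc 0 T, ∃ D : L2 Ω, HasCaputoDeriv α e t D ∧
      inner ℝ (Lp.posPart (w t)) D + μ * m t ^ 2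
        ≤ κ * ℰ t * inner ℝ (Lp.posPart (w t)) gL := by
    intro t ht
    obtain ⟨D, G, hD, hG, heq⟩ := he t ht
    refine ⟨D, hD, ?_⟩
    set ψ : Space d → ℝ := fun x => max (e t x - κ * E t * g x) 0 with hψ
    have hψm : MemLp ψ 2 (vol Ω) := (Lp.memLp (Lp.posPart (w t))).ae_eq (hwae t)
    have hRm : MemLp (R t) 2 (vol Ω) := (hR t ht).1.mono_exponent le_top
    have hcmp := hL.comparison hΩ ht hμ hg hg0 (hLg t ht) (mul_pos hκ (hE0 t)) hG
      (Lp.memLp D) hRm heq hψ hψm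
    have e1 : inner ℝ (Lp.posPart (w t)) D = ∫ x in Ω, D x * ψ x := by
      rw [inner_eq_integral]
      refine integral_congr_ae ?_
      filter_upwards [hwae t] with x hx
      rw [hx, mul_comm]
    have e2 : m t = l2norm Ω ψ := by
      rw [hm]; simp only [Lp.norm_def, l2norm]
      rw [eLpNorm_congr_ae (hwae t)]
    have e3 : inner ℝ (Lp.posPart (w t)) gL = ∫ x in Ω, g x * ψ x := by
      rw [inner_eq_integral]
      refine integral_congr_ae ?_
      filter_upwards [hwae t, hgm.coeFn_toLp] with x hx hx'
      rw [hx, hx', mul_comm]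
    have hψi : Integrable ψ (vol Ω) := hψm.integrable (by norm_num)
    have e4 : ∫ x in Ω, R t x * ψ x ≤ κ * (ℰ t + lam * E t) * ∫ x in Ω, ψ x := by
      rw [← integral_const_mul]
      refine integral_mono_ae (hRm.integrable_mul hψm) (hψi.const_mul _) ?_
      filter_upwards [(hR t ht).ae_abs_le] with x hx
      exact mul_le_mul_of_nonneg_right ((le_abs_self _).trans hx) (le_max_right _ _)
    have e5 : ∫ x in Ω, ψ x ≤ ∫ x in Ω, g x * ψ x := by
      refine integral_mono_ae hψi (hgm.integrable_mul hψm)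
        (ae_restrict_of_forall_mem hΩ.measurableSet fun x hx => ?_)
      exact le_mul_of_one_le_left (le_max_right _ _) (hgB x hx).1
    have e6 := mul_le_mul_of_nonneg_left e5 (mul_nonneg hκ.le (hE t ht).1)
    rw [e1, e2, e3]
    linarith
  -- on a short time interval the first term of the Caputo derivative dominates `μ`
  obtain ⟨δ, hδ, hδμ⟩ : ∃ δ : ℝ, 0 < δ ∧ Real.Gamma (1 - α) * |μ| < δ ^ (-α) := by
    have h0 : 0 < Real.Gamma (1 - α) * |μ| + 1 := by positivity
    refine ⟨(Real.Gamma (1 - α) * |μ| + 1) ^ (-α)⁻¹, by positivity, ?_⟩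
    rw [Real.rpow_inv_rpow h0.le (neg_ne_zero.2 hα.1.ne')]
    linarith
  have hstep : ∀ q, 0 ≤ q → (∀ t ∈ Icc 0 T, t ≤ q → m t = 0) →
      ∀ t ∈ Icc 0 T, t ≤ q + δ → m t = 0 := by
    intro q hq hmq t₁ ht₁ ht₁q
    obtain ⟨t, ht, htmax⟩ := isCompact_Icc.exists_isMaxOn (nonempty_Icc.2 ht₁.1)
      (hmc.mono (Icc_subset_Icc le_rfl ht₁.2))
    have htT : t ∈ Icc 0 T := ⟨ht.1, ht.2.trans ht₁.2⟩
    by_contra hne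
    have hmt : 0 < m t := lt_of_lt_of_le (lt_of_le_of_ne (hmnn t₁) (Ne.symm hne))
      (htmax (right_mem_Icc.2 ht₁.1))
    have hqt : q < t := by
      by_contra h
      exact hmt.ne' (hmq t htT (not_lt.1 h))
    have ht0 : 0 < t := hq.trans_lt hqt
    obtain ⟨D, hD, hle⟩ := hell t ⟨ht0, htT.2⟩
    obtain ⟨hE1, hE2⟩ := hE t ⟨ht0, htT.2⟩
    set P := Lp.posPart (w t) with hP
    set G₀ : ℝ := inner ℝ P gL with hG₀
    -- the scalar function `p s = ⟨w s, P⟩`, whose right limit at `0` is `-κ E(0) ⟨g, P⟩`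
    have hpc := (hD.clm ht0 (innerSL ℝ P)).sub ht0
      (hE2.clm ht0 ((κ * G₀) • ContinuousLinearMap.id ℝ ℝ))
    simp only [innerSL_apply_apply, smul_apply, ContinuousLinearMap.id_apply,
      smul_eq_mul] at hpc
    have hpw : ∀ s, inner ℝ P (e s) - κ * G₀ * E s = inner ℝ P (w s) := fun s => by
      rw [hw]; simp only [inner_sub_right, inner_smul_right]; rw [← hG₀]; ring
    have hp0 : Tendsto (fun s => inner ℝ P (e s) - κ * G₀ * E s) (𝓝[>] 0)
        (𝓝 (-(κ * G₀ * E 0))) := by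
      have h1 : Tendsto e (𝓝[>] 0) (𝓝 (e 0)) :=
        (hec 0 ⟨le_rfl, htT.1.trans htT.2⟩).mono_left
          (nhdsWithin_le_of_mem (mem_of_superset (Ioo_mem_nhdsGT (ht0.trans_le htT.2))
            Ioo_subset_Icc_self))
      have h2 := (tendsto_const_nhds (x := P)).inner h1 (𝕜 := ℝ)
      have h3 := (hEc.tendsto 0).mono_left (nhdsWithin_le_nhds (s := Ioi 0))
      have := h2.sub (h3.const_mul (κ * G₀))
      simpa [he0] using this
    have hpt : inner ℝ P (w t) = m t ^ 2 := inner_posPart_self (w t)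
    have hps : ∀ s, inner ℝ P (w s) ≤ m t * m s := fun s => inner_posPart_le (w t) (w s)
    have hlow := hpc.lower_bound hα hq hqt hp0
      (fun s hs => by
        simp only [hpw]
        refine (hps s).trans (le_of_eq ?_)
        rw [hmq s ⟨hs.1.le, (hs.2.trans hqt.le).trans htT.2⟩ hs.2, mul_zero])
      (fun s hs => by
        simp only [hpw, hpt]
        refine (hps s).trans ?_
        rw [sq]
        exact mul_le_mul_of_nonneg_left (htmax ⟨hs.1.le, hs.2.trans ht.2⟩) (hmnn t))
    simp only [hpw, hpt] at hlow
    have hΓ' : Real.Gamma (1 - α) * (inner ℝ P D - κ * G₀ *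
        (ℰ t - (Real.Gamma (1 - α))⁻¹ * t ^ (-α) * E 0)) + t ^ (-α) * -(κ * G₀ * E 0)
        = Real.Gamma (1 - α) * (inner ℝ P D - κ * ℰ t * G₀) := by
      field_simp; ring
    rw [hΓ'] at hlow
    have h1 : δ ^ (-α) ≤ (t - q) ^ (-α) :=
      Real.rpow_le_rpow_of_nonpos (sub_pos.2 hqt) (by linarith [ht.2]) (by linarith [hα.1])
    have h2 : Real.Gamma (1 - α) * (inner ℝ P D - κ * ℰ t * G₀)
        ≤ Real.Gamma (1 - α) * |μ| * m t ^ 2 := by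
      rw [mul_assoc (Real.Gamma (1 - α)) |μ|]
      refine mul_le_mul_of_nonneg_left ?_ hΓ.le
      have := mul_le_mul_of_nonneg_right (neg_abs_le μ) (sq_nonneg (m t))
      linarith
    have h3 : 0 < m t ^ 2 := by positivity
    have h4 := mul_le_mul_of_nonneg_right h1 h3.le
    have h5 := mul_lt_mul_of_pos_right hδμ h3
    linarith
  have hind : ∀ n : ℕ, ∀ t ∈ Icc 0 T, t ≤ n * δ → m t = 0 := by
    intro n
    induction n with
    | zero =>
      intro t ht htn
      rw [Nat.cast_zero, zero_mul] at htn
      rw [le_antisymm htn ht.1, hmz]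
    | succ n ih =>
      intro t ht htn
      refine hstep (n * δ) (by positivity) ih t ht ?_
      push_cast at htn; linarith
  intro t ht
  obtain ⟨n, hn⟩ := exists_nat_ge (t / δ)
  exact hind n t ht ((div_le_iff₀ hδ).1 hn)

/-- `L(t) g` at a point only depends on `g` near this point. -/
lemma apply_congr_of_eqOn (hΩ : IsOpen Ω) {g h : Space d → ℝ} (hgh : EqOn g h Ω) {t : ℝ}
    {x : Space d} (hx : x ∈ Ω) : L.apply t g x = L.apply t h x := by
  have h1 : ∀ i, EqOn (pderiv i g) (pderiv i h) Ω := fun i y hy => by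
    have := (hgh.eventuallyEq_of_mem (hΩ.mem_nhds hy)).fderiv_eq (𝕜 := ℝ)
    simp only [pderiv, this]
  have h2 : ∀ i j, pderiv i (fun y => L.a t y i j * pderiv j g y) x
      = pderiv i (fun y => L.a t y i j * pderiv j h y) x := fun i j => by
    have h3 : EqOn (fun y => L.a t y i j * pderiv j g y)
        (fun y => L.a t y i j * pderiv j h y) Ω := fun y hy => by simp only [h1 j hy]
    have := (h3.eventuallyEq_of_mem (hΩ.mem_nhds hx)).fderiv_eq (𝕜 := ℝ)
    rw [pderiv, this, ← pderiv]
  simp only [SpatialOperator.apply, h2, h1 _ hx, hgh hx]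

/-- The error bound for a general barrier `κ E(t) g(x)`. -/
theorem linftyLE_error (hΩ : IsOpen Ω) (hΩb : Bornology.IsBounded Ω) (hα : α ∈ Ioo (0 : ℝ) 1)
    (hL : L.IsElliptic Ω T) {μ : ℝ} (hμ : L.LowerBound Ω T μ) {f : ℝ → Space d → ℝ} {u₀ : L2 Ω}
    {u uh : ℝ → L2 Ω} (hu : IsSolution Ω T α L f u₀ u) (huh : HasRegularity Ω T uh)
    (huh₀ : uh 0 = u₀) {R : ℝ → Space d → ℝ}
    (hres : ∀ t ∈ Ioc 0 T, IsResidualAt Ω α L f uh t (R t))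
    {lam ω : ℝ} (hω : 0 ≤ ω) {g : Space d → ℝ} (hg : ContDiffOn ℝ 2 g Ω)
    (hLg : ∀ t ∈ Ioc 0 T, ∀ x ∈ Ω, lam ≤ L.apply t g x)
    (hgB : ∀ x ∈ Ω, 1 ≤ g x ∧ g x ≤ 1 + ω) {TOL : ℝ} (hTOL : 0 < TOL)
    {E ℰ : ℝ → ℝ} (hEc : Continuous E) (hE0 : ∀ s, 0 < E s)
    (hE : ∀ t ∈ Ioc 0 T, 0 ≤ ℰ t ∧
      HasCaputoDeriv α E t (ℰ t - (Real.Gamma (1 - α))⁻¹ * t ^ (-α) * E 0))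
    (hR : ∀ t ∈ Ioc 0 T, LinftyLE Ω (R t) (TOL * (ℰ t + lam * E t) / (1 + ω))) :
    ∀ t ∈ Icc 0 T, ∀ᵐ x ∂vol Ω, |(uh t - u t : L2 Ω) x| ≤ TOL * E t := by
  classical
  have := isFiniteMeasure_vol hΩb
  have hω1 : 0 < 1 + ω := by linarith
  -- only the values of `g` in `Ω` matter; elsewhere `g` is made positive
  set g₁ : Space d → ℝ := fun x => if x ∈ Ω then g x else 1 with hg₁
  have hgg : EqOn g g₁ Ω := fun x hx => by simp [hg₁, hx]
  have hg₁0 : ∀ x, 0 < g₁ x := fun x => by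
    by_cases hx : x ∈ Ω
    · rw [← hgg hx]; linarith [(hgB x hx).1]
    · simp [hg₁, hx]
  have hg₁c : ContDiffOn ℝ 2 g₁ Ω := hg.congr fun x hx => (hgg hx).symm
  have hLg₁ : ∀ t ∈ Ioc 0 T, ∀ x ∈ Ω, lam ≤ L.apply t g₁ x := fun t ht x hx => by
    rw [← apply_congr_of_eqOn hΩ hgg hx]; exact hLg t ht x hx
  have hg₁B : ∀ x ∈ Ω, 1 ≤ g₁ x ∧ g₁ x ≤ 1 + ω := fun x hx => by
    rw [← hgg hx]; exact hgB x hx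
  have hR2 : ∀ t ∈ Ioc 0 T, MemLp (R t) 2 (vol Ω) := fun t ht =>
    (hR t ht).1.mono_exponent le_top
  have hz2 : MemLp (0 : Space d → ℝ) 2 (vol Ω) := MemLp.zero
  have hκ : 0 < TOL / (1 + ω) := by positivity
  have heq0 : uh 0 = u 0 := by rw [huh₀, hu.initial]
  have hup := le_barrier hΩ hΩb hα hL hμ hκ hg₁c hg₁0 hLg₁ hg₁B hEc hE0 hE
    (huh.cont.sub hu.regular.cont) (sub_eq_zero.2 heq0)
    (fun t ht => (hres t ht).sub hL hΩ ht (hu.equation t ht) (hR2 t ht) hz2)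
    (fun t ht => by
      have := hR t ht
      rw [mul_div_right_comm] at this
      simpa using this)
  have hlo := le_barrier hΩ hΩb hα hL hμ hκ hg₁c hg₁0 hLg₁ hg₁B hEc hE0 hE
    (hu.regular.cont.sub huh.cont) (sub_eq_zero.2 heq0.symm)
    (fun t ht => (hu.equation t ht).sub hL hΩ ht (hres t ht) hz2 (hR2 t ht))
    (fun t ht => by
      have := hR t ht
      rw [mul_div_right_comm] at this
      have h0 : (fun x => (0 : Space d → ℝ) x - R t x) = -R t := by funext x; simp
      rw [h0]
      exact ⟨this.1.neg, by rw [eLpNorm_neg]; exact this.2⟩)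
  intro t ht
  filter_upwards [hup t ht, hlo t ht, Lp.coeFn_sub (uh t) (u t), Lp.coeFn_sub (u t) (uh t),
    ae_restrict_mem hΩ.measurableSet] with x h1 h2 h3 h4 hx
  have h5 : TOL / (1 + ω) * E t * g₁ x ≤ TOL * E t := by
    calc TOL / (1 + ω) * E t * g₁ x ≤ TOL / (1 + ω) * E t * (1 + ω) :=
          mul_le_mul_of_nonneg_left (hg₁B x hx).2 (mul_nonneg hκ.le (hE0 t).le)
      _ = TOL * E t := by field_simp
  rw [Pi.sub_apply, h4, Pi.sub_apply] at h2
  rw [Pi.sub_apply, h3, Pi.sub_apply] at h1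
  rw [h3, Pi.sub_apply]
  exact abs_le.2 ⟨by linarith, by linarith⟩

end Comparison

end Subdiffusion

theorem mainTheorem2 {d : ℕ} (hd : 1 ≤ d) {Ω : Set (Space d)} (hΩ : IsOpen Ω)
    (hΩb : Bornology.IsBounded Ω) {T α : ℝ} (hT : 0 < T) (hα : α ∈ Set.Ioo (0 : ℝ) 1)
    (L : SpatialOperator d) (hL : L.IsElliptic Ω T)
    (μ : ℝ) (hLμ : L.LowerBound Ω T μ)
    (f : ℝ → Space d → ℝ) (hf : ∀ t ∈ Set.Ioc 0 T, LocallyIntegrableOn (f t) Ω)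
    (u₀ : L2 Ω) (u uh : ℝ → L2 Ω) (hu : IsSolution Ω T α L f u₀ u)
    (huh : HasRegularity Ω T uh) (huh₀ : uh 0 = u₀)
    (R : ℝ → Space d → ℝ) (hR : ∀ t ∈ Set.Ioc 0 T, IsResidualAt Ω α L f uh t (R t))
    (lam ω : ℝ) (hω : 0 ≤ ω)
    (g : Space d → ℝ) (hg : ContDiffOn ℝ 2 g Ω)
    (hLg : ∀ t ∈ Set.Ioc 0 T, ∀ x ∈ Ω, lam ≤ L.apply t g x)
    (hg_bound : ∀ x ∈ Ω, 1 ≤ g x ∧ g x ≤ 1 + ω)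
    (TOL τ : ℝ) (hTOL : 0 < TOL) (hτ : 0 < τ) :
    ((∀ t ∈ Set.Ioc 0 T, LinftyLE Ω (R t) (TOL * barrier₀ α lam t / (1 + ω))) →
      ∀ t ∈ Set.Icc 0 T, LinftyLE Ω (uh t - u t : L2 Ω) TOL) ∧
    ((∀ t ∈ Set.Ioc 0 T, LinftyLE Ω (R t) (TOL * barrier₁ α lam τ t / (1 + ω))) →
      ∀ t ∈ Set.Ioc 0 T, LinftyLE Ω (uh t - u t : L2 Ω) (TOL * t ^ (α - 1))) := by
  have hΓ : 0 < Real.Gamma (1 - α) := Real.Gamma_pos_of_pos (by linarith [hα.2])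
  refine ⟨fun hbd t ht => ?_, fun hbd t ht => ?_⟩
  · refine linftyLE_of_ae_abs_le (Lp.aestronglyMeasurable _) hTOL.le ?_
    have := linftyLE_error hΩ hΩb hα hL hLμ hu huh huh₀ hR hω hg hLg hg_bound hTOL
      (E := fun _ => 1) (ℰ := fun t => (Real.Gamma (1 - α))⁻¹ * t ^ (-α)) continuous_const
      (fun _ => one_pos)
      (fun t ht => ⟨by have := ht.1; positivity, by
        simpa using hasCaputoDeriv_const (α := α) (t := t) (c := 1)⟩)
      (fun t ht => by simpa only [mul_one, barrier₀] using hbd t ht) t ht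
    simpa only [mul_one] using this
  · have htpos : 0 < t := ht.1
    refine linftyLE_of_ae_abs_le (Lp.aestronglyMeasurable _) (by positivity) ?_
    have hpos : ∀ s, 0 < max τ s := fun s => lt_max_of_lt_left hτ
    have := linftyLE_error hΩ hΩb hα hL hLμ hu huh huh₀ hR hω hg hLg hg_bound hTOL
      (E := fun s => (max τ s) ^ (α - 1))
      (ℰ := fun t => (Real.Gamma (1 - α))⁻¹ * t⁻¹ * rho α (τ / t))
      ((continuous_const.max continuous_id).rpow_const fun s => Or.inl (hpos s).ne')
      (fun s => Real.rpow_pos_of_pos (hpos s) _)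
      (fun t ht => ⟨mul_nonneg (mul_nonneg (inv_nonneg.2 hΓ.le) (inv_nonneg.2 ht.1.le))
        (rho_nonneg hα.2 (div_pos hτ ht.1)), by
        have h := hasCaputoDeriv_max_rpow hα hτ ht.1
        rw [max_eq_left hτ.le]
        convert h using 1
        ring⟩)
      (fun t ht => hbd t ht) t ⟨ht.1.le, ht.2⟩
    filter_upwards [this] with x hx
    refine hx.trans (mul_le_mul_of_nonneg_left ?_ hTOL.le)
    exact Real.rpow_le_rpow_of_nonpos htpos (le_max_right _ _) (by linarith [hα.2])
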